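/- **Probabilistic zero forcing.** Let $G$ be a finite graph with a set of blue vertices; the other vertices are white. In each round, if $Z$ is the current set of blue vertices, every $u\in Z$ attempts, independently, to force each of its white neighbours, and each attempt succeeds with probability $|N[u]\cap Z|/\deg(u)$; a white vertex becomes blue if at least one attempt on it succeeds. Let $pt(G)$ be the minimum, over all vertices $v$ of $G$, of the number of rounds until all vertices are blue in a run started with $v$ as the only blue vertex, where the runs for different $v$ are independent. Let $G_{n\times n}$ be the $n\times n$ grid (the Cartesian product of two paths on $n$ vertices). **The $d$-window chain.** For $d\ge 2$ let $P_d$ be the following Markov chain on $\{0,1\}^d$ ($1$ is blue, $0$ is white). From $C=(c_1,\dots,c_d)\ne(0,\dots,0)$, put $c_0=c_{d+1}=0$ and draw independent bits $u_0,\dots,u_d$ with $\mathbb P(u_k=1)=1-(1/4)^{c_k+c_{k+1}}$; the next state is whichever of $(u_0,\dots,u_{d-1})$ and $(u_1,\dots,u_d)$ has more ones, and one of the two chosen uniformly at random if they have equally many. From $(0,\dots,0)$ the next state has exactly three ones, consecutive and centred: for odd $d$ it is $0^{(d-3)/2}\,1^3\,0^{(d-3)/2}$; for even $d\ge4$ it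 is $0^{(d-4)/2}\,1^3\,0^{(d-2)/2}$ or $0^{(d-2)/2}\,1^3\,0^{(d-4)/2}$, with probability $1/2$ each; for $d=2$ it is $(1,1)$. **Statement.** Fix $d\ge 2$. The chain $P_d$ has a stationary distribution which is its limiting distribution from every initial state. Let $\mu_d$ be the probability of the all-white state $(0,\dots,0)$ in it. Then $\mu_d<1/2$, and there is a sequence $\varepsilon_n\to0$ such that $$\lim_{n\to\infty}\mathbb P\left(pt(G_{n\times n})\le(1+\varepsilon_n)\,\frac{1-\mu_d}{1-2\mu_d}\,n\right)=1 .$$ -/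

import Mathlib

open Filter Topology MeasureTheory

noncomputable section

namespace PZF

/-! ## Probabilistic zero forcing -/

/-- The probability `|N[u] ∩ Z| / deg u` with which, when `Z` is the set of blue vertices,
the blue vertex `u` forces a given white neighbour during one round. -/
def forceProb {V : Type*} (G : SimpleGraph V) (Z : Set V) (u : V) : ℝ :=
  ((insert u (G.neighborSet u) ∩ Z).ncard : ℝ) / ((G.neighborSet u).ncard : ℝ)

/-- Sample space of one run: a number in `[0, 1]` for every round `t` and every ordered pair
`(u, w)`, deciding the attempt of `u` to force `w` in round `t + 1`. -/
abbrev RunSpace (V : Type*) : Type _ := ℕ × V × V → unitInterval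

/-- In a run the numbers are independent and uniformly distributed on `[0, 1]`. -/
def runMeasure (V : Type*) : Measure (RunSpace V) :=
  Measure.infinitePi fun _ : ℕ × V × V => (volume : Measure unitInterval)

/-- The set of blue vertices after `t` rounds, when `Z` is the initial set of blue vertices:
in each round every blue vertex `u` attempts to force each of its white neighbours `w`, and
succeeds when the uniform number of this attempt is at most `forceProb`. -/
def blueSet {V : Type*} (G : SimpleGraph V) (Z : Set V) (ω : RunSpace V) : ℕ → Set V
  | 0 => Z
  | t + 1 => blueSet G Z ω t ∪
      {w | ∃ u ∈ blueSet G Z ω t, G.Adj u w ∧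
        (ω (t, u, w) : ℝ) ≤ forceProb G (blueSet G Z ω t) u}

/-- The propagation time of one run with initial blue set `Z`: the least number of rounds after
which all vertices are blue (`⊤` if this never happens). -/
def runPropTime {V : Type*} (G : SimpleGraph V) (Z : Set V) (ω : RunSpace V) : ℕ∞ :=
  ⨅ (t : ℕ) (_ : blueSet G Z ω t = Set.univ), (t : ℕ∞)

/-- The sample space of the experiment that performs one run for each vertex. -/
abbrev ExpSpace (V : Type*) : Type _ := V → RunSpace V

/-- The runs for different vertices are independent. -/
def expMeasure (V : Type*) [Fintype V] : Measure (ExpSpace V) :=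
  Measure.pi fun _ : V => runMeasure V

/-- The propagation time of the graph: the minimum over the vertices `v` of the propagation time
of the run for `v`, which starts with `v` as its only blue vertex. -/
def propTime {V : Type*} (G : SimpleGraph V) (ω : ExpSpace V) : ℕ∞ :=
  ⨅ v : V, runPropTime G {v} (ω v)

/-- The `m` by `n` grid: the Cartesian product of the paths on `m` and on `n` vertices. -/
def grid (m n : ℕ) : SimpleGraph (Fin m × Fin n) :=
  (SimpleGraph.pathGraph m).boxProd (SimpleGraph.pathGraph n)

/-! ## The Markov chain of configurations of a window -/

/-- A configuration of a `d`-window; `true` is blue and `false` is white. -/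
abbrev Config (d : ℕ) : Type := Fin d → Bool

/-- The all white configuration. -/
def allWhite (d : ℕ) : Config d := fun _ => false

/-- The all blue configuration. -/
def allBlue (d : ℕ) : Config d := fun _ => true

/-- The number of blue vertices of a configuration. -/
def blueCount {d : ℕ} (C : Config d) : ℕ := (Finset.univ.filter fun i => C i = true).card

/-- Let `v 0, …, v (d - 1)` be the vertices of a window with configuration `C`, from top left to
bottom right. Its neighbours on the next diagonal are `u 0, …, u d`, where `u k` is adjacent to
`v (k - 1)` (if `1 ≤ k`) and to `v k` (if `k < d`). This is the number of blue vertices of the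
window that are adjacent to `u k`. -/
def blueNbrs {d : ℕ} (C : Config d) (k : Fin (d + 1)) : ℕ :=
  ((Fin.cons false C : Config (d + 1)) k).toNat + ((Fin.snoc C false : Config (d + 1)) k).toNat

/-- The probability that `u k` turns blue: `15/16`, `3/4` or `0` if it is adjacent to two, one or
no blue vertices of the window. -/
def turnBlueProb {d : ℕ} (C : Config d) (k : Fin (d + 1)) : ℝ := 1 - (1 / 4) ^ blueNbrs C k

/-- The probability that the next diagonal `u 0, …, u d` gets the colours `U`. -/
def diagProb {d : ℕ} (C : Config d) (U : Config (d + 1)) : ℝ :=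
  ∏ k, if U k = true then turnBlueProb C k else 1 - turnBlueProb C k

/-- The next window is whichever of `X = (u 0, …, u (d - 1))` and `Y = (u 1, …, u d)` has more
blue vertices, and one of the two chosen uniformly at random if they have equally many. This is
the probability that its configuration is `C'` when the next diagonal has the colours `U`. -/
def selectProb {d : ℕ} (U : Config (d + 1)) (C' : Config d) : ℝ :=
  let X : Config d := Fin.init U
  let Y : Config d := Fin.tail U
  if blueCount Y < blueCount X then (if C' = X then 1 else 0)
  else if blueCount X < blueCount Y then (if C' = Y then 1 else 0)
  else (1 / 2) * (if C' = X then 1 else 0) + (1 / 2) * (if C' = Y then 1 else 0)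

/-- The configuration whose blue vertices are those at the positions `a`, `a + 1`, `a + 2`
(counted from `0`). -/
def threeBlue (d a : ℕ) : Config d := fun i => decide (a ≤ (i : ℕ) ∧ (i : ℕ) < a + 3)

/-- The transition probabilities from the all white configuration: to three consecutive centred
blue vertices (with a uniform choice between the two most central positions if `d` is even), and
to the all blue configuration if `d = 2`. -/
def resetProb (d : ℕ) (C' : Config d) : ℝ :=
  if d = 2 then (if C' = allBlue d then 1 else 0)
  else if Odd d then (if C' = threeBlue d ((d - 3) / 2) then 1 else 0)
  else (1 / 2) * (if C' = threeBlue d ((d - 4) / 2) then 1 else 0)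
    + (1 / 2) * (if C' = threeBlue d ((d - 2) / 2) then 1 else 0)

/-- The transition matrix of the `d`-window Markov chain (meant for `2 ≤ d`). -/
def windowChain (d : ℕ) : Matrix (Config d) (Config d) ℝ := fun C C' =>
  if C = allWhite d then resetProb d C' else ∑ U : Config (d + 1), diagProb C U * selectProb U C'

/-- `π` is a stationary probability distribution of the transition matrix `P`. -/
def IsStationary {S : Type*} [Fintype S] (P : Matrix S S ℝ) (π : S → ℝ) : Prop :=
  (∀ x, 0 ≤ π x) ∧ ∑ x, π x = 1 ∧ Matrix.vecMul π P = π

/-- `π` is the limiting distribution of the transition matrix `P`: from every initial state `x`,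
the law of the chain after `t` steps converges to `π`. -/
def IsLimiting {S : Type*} [Fintype S] [DecidableEq S] (P : Matrix S S ℝ) (π : S → ℝ) : Prop :=
  ∀ x y, Tendsto (fun t : ℕ => (P ^ t) x y) atTop (𝓝 (π y))

end PZF

end

/-! Near a centre, write vertices as `(i, j)`, with level `i + j` and transversal coordinate `i -
j`. Suppose that all vertices dominated by `(i, j)`, within a band `|i - j| ≤ M` and above a base
level `b`, are blue. Then `(i, j)` has three blue vertices in its closed neighbourhood and forces
upwards and to the right with probability at least 3/4. The other vertices of the top row of this
cone also have a blue right neighbour, so they force upwards with certainty. Hence a window whose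
blue vertices carry blue cones evolves like `P_d`. If a whole round of attempts fails, the cones
still spread sideways on their own level, which yields the three consecutive vertices of the reset.
Entering the all white state costs a round and raises the level by 1; the reset costs no round and
lowers the level by 1. A stationary step therefore gains `1 - 2μ` levels in `1 - μ` rounds on
average, so the speed is `γ = (1 - 2μ) / (1 - μ)`. By reflection symmetry the transversal coordinate
has no drift. Concentration comes from second moments. Solutions of the Poisson equation
(`exists_poisson`) turn level and transversal coordinate into martingales, and backward induction
with a quadratic Lyapunov function (`sum_lyapunov_le`, `fail_mul_le_lyapunov`) shows that `(l, l)`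
is blue after about `2l / γ` rounds, except with probability `O(l / M²)`. To cover the grid, `s`
diagonal runs of length `l ≈ n / (2(s + 1))`, each towards one of four quadrants, are concatenated
by `fail_add`. They take about `n / γ` rounds and reach every point of a lattice of mesh `2l`. The
crude bound `fail_le_of_dist` fills the gaps in `O(n / s)` further rounds. Finally the tolerance
tends to zero slowly with `n`. -/

noncomputable section

namespace PZF

/-! ### Runs: Markov property and monotonicity. -/

section Rounds

variable {V : Type*} {G : SimpleGraph V}

/-- The set of blue vertices after one round, when `η` holds the uniform numbers of the round. -/
def stepSet (G : SimpleGraph V) (Z : Set V) (η : V × V → unitInterval) : Set V :=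
  Z ∪ {w | ∃ u ∈ Z, G.Adj u w ∧ (η (u, w) : ℝ) ≤ forceProb G Z u}

/-- The law of the uniform numbers of one round. -/
def roundMeasure (V : Type*) : Measure (V × V → unitInterval) :=
  Measure.infinitePi fun _ : V × V => (volume : Measure unitInterval)

instance : IsProbabilityMeasure (roundMeasure V) := by
  unfold roundMeasure; infer_instance

instance : IsProbabilityMeasure (runMeasure V) := by
  unfold runMeasure; infer_instance

/-- Put one round in front of a run. -/
def consRound (p : (V × V → unitInterval) × RunSpace V) : RunSpace V
  | (0, e) => p.1 e
  | (t + 1, e) => p.2 (t, e)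

lemma measurable_consRound : Measurable (consRound (V := V)) := by
  refine measurable_pi_iff.2 ?_
  rintro ⟨_ | t, e⟩
  · exact (measurable_pi_apply e).comp measurable_fst
  · exact (measurable_pi_apply (t, e)).comp measurable_snd

/-- The Markov property: a run is one round followed by an independent fresh run. It is checked on
boxes, whose coordinates split into those of round 0 and those of later rounds. -/
lemma map_consRound :
    ((roundMeasure V).prod (runMeasure V)).map consRound = runMeasure V := by
  classical
  refine Measure.eq_infinitePi _ fun s t ht => ?_
  set f0 : V × V → ℕ × V × V := fun e => (0, e)
  set f1 : ℕ × V × V → ℕ × V × V := fun e => (e.1 + 1, e.2)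
  have h0 : Function.Injective f0 := fun a b h => by simpa [f0] using h
  have h1 : Function.Injective f1 := fun a b h => by
    simp only [f1, Prod.mk.injEq, add_left_inj] at h
    exact Prod.ext h.1 h.2
  have hpre : consRound ⁻¹' (Set.pi (s : Set (ℕ × V × V)) t) =
      (Set.pi ((s.preimage f0 h0.injOn : Finset _) : Set (V × V)) fun e => t (f0 e)) ×ˢ
      (Set.pi ((s.preimage f1 h1.injOn : Finset _) : Set (ℕ × V × V)) fun e => t (f1 e)) := by
    ext ⟨η, ω⟩
    simp only [Set.mem_preimage, Set.mem_pi, Set.mem_prod, Finset.mem_coe, Finset.mem_preimage]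
    constructor
    · intro h
      exact ⟨fun e he => h (f0 e) he, fun e he => h (f1 e) he⟩
    · rintro ⟨h, h'⟩ ⟨_ | k, e⟩ he
      · exact h e he
      · exact h' (k, e) he
  rw [Measure.map_apply measurable_consRound
    (MeasurableSet.pi s.countable_toSet fun i _ => ht i), hpre, Measure.prod_prod, roundMeasure,
    runMeasure, Measure.infinitePi_pi _ fun i _ => ht _, Measure.infinitePi_pi _ fun i _ => ht _]
  rw [Finset.prod_preimage' f0 s h0.injOn (fun i => (volume : Measure unitInterval) (t i)),
    Finset.prod_preimage' f1 s h1.injOn (fun i => (volume : Measure unitInterval) (t i)),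
    ← Finset.prod_filter_mul_prod_filter_not s (fun i => i ∈ Set.range f0)]
  congr 1
  refine Finset.prod_congr (Finset.filter_congr ?_) fun _ _ => rfl
  rintro ⟨_ | k, e⟩ _ <;> simp [f0, f1]

lemma blueSet_consRound (Z : Set V) (η : V × V → unitInterval) (ω : RunSpace V) (t : ℕ) :
    blueSet G Z (consRound (η, ω)) (t + 1) = blueSet G (stepSet G Z η) ω t := by
  induction t with
  | zero => rfl
  | succ t ih =>
    rw [blueSet, ih]
    rfl

lemma subset_stepSet (Z : Set V) (η : V × V → unitInterval) : Z ⊆ stepSet G Z η :=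
  Set.subset_union_left

lemma subset_blueSet (Z : Set V) (ω : RunSpace V) (t : ℕ) : Z ⊆ blueSet G Z ω t := by
  induction t with
  | zero => exact subset_rfl
  | succ t ih => exact ih.trans Set.subset_union_left

/-- The probability that after `t` rounds not all vertices of `B` are blue, when `Z` is the
initial set of blue vertices. -/
def fail (G : SimpleGraph V) (Z B : Set V) (t : ℕ) : ℝ :=
  (runMeasure V).real {ω | ¬ B ⊆ blueSet G Z ω t}

lemma fail_nonneg (Z B : Set V) (t : ℕ) : 0 ≤ fail G Z B t := measureReal_nonneg

lemma fail_le_one (Z B : Set V) (t : ℕ) : fail G Z B t ≤ 1 := measureReal_le_one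

lemma fail_eq_zero {Z B : Set V} (h : B ⊆ Z) (t : ℕ) : fail G Z B t = 0 := by
  have : {ω : RunSpace V | ¬ B ⊆ blueSet G Z ω t} = ∅ := by
    ext ω
    simpa using h.trans (subset_blueSet Z ω t)
  rw [fail, this, measureReal_empty]

lemma fail_zero_of_not_subset {Z B : Set V} (h : ¬ B ⊆ Z) : fail G Z B 0 = 1 := by
  have : {ω : RunSpace V | ¬ B ⊆ blueSet G Z ω 0} = Set.univ := by
    ext ω
    simpa [blueSet] using h
  rw [fail, this, probReal_univ]

lemma fail_biUnion_le {ι : Type*} (I : Finset ι) (Z : Set V) (B : ι → Set V) (t : ℕ) :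
    fail G Z (⋃ i ∈ I, B i) t ≤ ∑ i ∈ I, fail G Z (B i) t := by
  refine le_trans (measureReal_mono ?_ (measure_ne_top _ _)) (measureReal_biUnion_finset_le I _)
  intro ω hω
  by_contra hc
  simp only [Set.mem_iUnion, not_exists, Set.mem_ofPred_eq, not_not] at hc
  exact hω (Set.iUnion₂_subset hc)

section Finite

variable [Finite V]

lemma forceProb_mono {Z Z' : Set V} (h : Z ⊆ Z') (u : V) : forceProb G Z u ≤ forceProb G Z' u := by
  unfold forceProb
  gcongr
  exact Set.toFinite _

/-- Monotone coupling: the same uniform numbers drive both runs, and more blue vertices only raise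
the thresholds. -/
lemma blueSet_mono {Z Z' : Set V} (h : Z ⊆ Z') (ω : RunSpace V) (t : ℕ) :
    blueSet G Z ω t ⊆ blueSet G Z' ω t := by
  induction t with
  | zero => exact h
  | succ t ih =>
    rintro w (hw | ⟨u, hu, huw, hη⟩)
    · exact Or.inl (ih hw)
    · exact Or.inr ⟨u, ih hu, huw, hη.trans (forceProb_mono ih u)⟩

lemma measurable_of_set {β : Type*} [MeasurableSpace β] (f : Set V → β) : Measurable f :=
  fun s _ => (Set.toFinite (f ⁻¹' s)).measurableSet

lemma measurable_blueSet (Z : Set V) (t : ℕ) :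
    Measurable fun ω : RunSpace V => blueSet G Z ω t := by
  induction t with
  | zero => exact measurable_const
  | succ t ih =>
    refine measurable_set_iff.2 fun w => ?_
    have h1 := measurable_set_iff.1 ih
    refine (h1 w).or (Measurable.exists fun u => (h1 u).and (measurable_const.and ?_))
    exact measurableSet_setOfPred.1 (measurableSet_le (by fun_prop)
      ((measurable_of_set fun Z => forceProb G Z u).comp ih))

lemma measurable_stepSet (Z : Set V) : Measurable fun η => stepSet G Z η := by
  refine measurable_set_iff.2 fun w => ?_
  refine measurable_const.or (Measurable.exists fun u =>
    measurable_const.and (measurable_const.and ?_))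
  exact measurableSet_setOfPred.1 (measurableSet_le (by fun_prop) measurable_const)

lemma measurableSet_fail (Z B : Set V) (t : ℕ) :
    MeasurableSet {ω : RunSpace V | ¬ B ⊆ blueSet G Z ω t} :=
  measurable_blueSet Z t (Set.toFinite {S : Set V | ¬ B ⊆ S}).measurableSet

lemma fail_mono {Z Z' B B' : Set V} (h : Z ⊆ Z') (hB : B' ⊆ B) (t : ℕ) :
    fail G Z' B' t ≤ fail G Z B t :=
  measureReal_mono fun ω hω hs => hω (hB.trans (hs.trans (blueSet_mono h ω t)))

lemma integrable_fail (Z B : Set V) (t : ℕ) (P : Measure (V × V → unitInterval))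
    [IsFiniteMeasure P] : Integrable (fun η => fail G (stepSet G Z η) B t) P := by
  refine Integrable.of_bound
    ((measurable_of_set fun Z => fail G Z B t).comp (measurable_stepSet Z)).aestronglyMeasurable 1
    (Eventually.of_forall fun η => ?_)
  rw [Real.norm_of_nonneg (fail_nonneg _ _ _)]
  exact fail_le_one _ _ _

lemma fail_succ (Z B : Set V) (t : ℕ) :
    fail G Z B (t + 1) = ∫ η, fail G (stepSet G Z η) B t ∂(roundMeasure V) := by
  have hm := measurableSet_fail (G := G) Z B (t + 1)
  have hm' : MeasurableSet (consRound ⁻¹' {ω : RunSpace V | ¬ B ⊆ blueSet G Z ω (t + 1)}) :=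
    measurable_consRound hm
  rw [fail, ← map_consRound, measureReal_def, Measure.map_apply measurable_consRound hm,
    Measure.prod_apply hm', ← integral_toReal (measurable_measure_prodMk_left hm').aemeasurable
      (Eventually.of_forall fun _ => measure_lt_top _ _)]
  refine integral_congr_ae (Eventually.of_forall fun η => ?_)
  simp only [fail, measureReal_def]
  congr 2
  ext ω
  simp [blueSet_consRound]

/-- Once `A` is blue, the remaining run starts from a superset of `A`, so by monotonicity it may be
replaced by a run from `A` itself. This allows runs to be concatenated. -/
lemma fail_add (Z A B : Set V) (s t : ℕ) :
    fail G Z B (s + t) ≤ fail G Z A s + fail G A B t := by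
  induction s generalizing Z with
  | zero =>
    by_cases h : A ⊆ Z
    · rw [Nat.zero_add]
      linarith [fail_mono (G := G) h subset_rfl (B := B) t, fail_nonneg (G := G) Z A 0]
    · rw [fail_zero_of_not_subset h, Nat.zero_add]
      linarith [fail_le_one (G := G) Z B t, fail_nonneg (G := G) A B t]
  | succ s ih =>
    rw [Nat.add_right_comm, fail_succ, fail_succ Z A]
    calc _ ≤ ∫ η, (fail G (stepSet G Z η) A s + fail G A B t) ∂(roundMeasure V) :=
          integral_mono (integrable_fail _ _ _ _)
            ((integrable_fail _ _ _ _).add (integrable_const _)) fun η => ih _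
      _ = _ := by
          rw [integral_add (integrable_fail _ _ _ _) (integrable_const _)]
          simp

end Finite

end Rounds

/-! ### A crude linear-time bound from distances. -/

lemma integral_ite_le {V : Type*} (e : V × V) (c : unitInterval) (a b : ℝ) :
    ∫ η, (if η e ≤ c then a else b) ∂(roundMeasure V) = c * a + (1 - c) * b := by
  have hm : MeasurableSet {η : V × V → unitInterval | η e ≤ c} :=
    measurableSet_le (measurable_pi_apply e) measurable_const
  have hc : (roundMeasure V).real {η | η e ≤ c} = c := by
    have : {η : V × V → unitInterval | η e ≤ c} = (fun η => η e) ⁻¹' Set.Iic c := rfl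
    rw [this, measureReal_def, roundMeasure,
      ← Measure.map_apply (measurable_pi_apply e) measurableSet_Iic, Measure.infinitePi_map_eval,
      unitInterval.volume_Iic]
    simp [c.2.1]
  have hs : (fun η : V × V → unitInterval => if η e ≤ c then a else b) =
      fun η => b + Set.indicator {η : V × V → unitInterval | η e ≤ c} (fun _ => a - b) η := by
    ext η
    by_cases h : η e ≤ c <;> simp [h]
  rw [hs, integral_add (integrable_const _) ((integrable_const _).indicator hm),
    integral_indicator_const _ hm, hc]
  simp
  ring

lemma one_div_four_le_forceProb {V : Type*} [Finite V] {G : SimpleGraph V}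
    (hdeg : ∀ u, (G.neighborSet u).ncard ≤ 4) {Z : Set V} {u w : V} (hu : u ∈ Z)
    (huw : G.Adj u w) : 1 / 4 ≤ forceProb G Z u := by
  have h1 : 1 ≤ (insert u (G.neighborSet u) ∩ Z).ncard :=
    (Set.ncard_pos).2 ⟨u, Set.mem_insert _ _, hu⟩
  have h2 : 1 ≤ (G.neighborSet u).ncard := (Set.ncard_pos).2 ⟨w, huw⟩
  have h3 : ((G.neighborSet u).ncard : ℝ) ≤ 4 := by exact_mod_cast hdeg u
  unfold forceProb
  have h1' : (1 : ℝ) ≤ (insert u (G.neighborSet u) ∩ Z).ncard := by exact_mod_cast h1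
  have h2' : (1 : ℝ) ≤ (G.neighborSet u).ncard := by exact_mod_cast h2
  gcongr

/-- A walk of length `D` that starts at a blue vertex is followed in `T` rounds except with
probability `4 ^ D * (13 / 16) ^ T`. -/
lemma fail_le_of_walk {V : Type*} [Finite V] {G : SimpleGraph V}
    (hdeg : ∀ u, (G.neighborSet u).ncard ≤ 4) (T : ℕ) {Z : Set V} {z w : V} (hz : z ∈ Z)
    (p : G.Walk z w) : fail G Z {w} T ≤ 4 ^ p.length * (13 / 16) ^ T := by
  induction T generalizing Z z with
  | zero =>
    refine (fail_le_one _ _ _).trans ?_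
    rw [pow_zero, mul_one]
    exact one_le_pow₀ (by norm_num)
  | succ T ih =>
    cases p with
    | nil =>
      rw [fail_eq_zero (by simpa using hz)]
      positivity
    | @cons _ x _ h q =>
      rw [fail_succ]
      -- In maximum degree 4 every attempt succeeds with probability at least 1/4; a success
      -- shortens the walk by its first edge.
      have key : ∀ η, fail G (stepSet G Z η) {w} T ≤
          if η (z, x) ≤ (⟨1 / 4, by norm_num, by norm_num⟩ : unitInterval)
          then 4 ^ q.length * (13 / 16) ^ T else 4 ^ (q.length + 1) * (13 / 16) ^ T := by
        intro η
        split_ifs with hη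
        · exact ih (Or.inr ⟨z, hz, h, le_trans hη (one_div_four_le_forceProb hdeg hz h)⟩) q
        · exact ih (subset_stepSet _ _ hz) (SimpleGraph.Walk.cons h q)
      refine (integral_mono (integrable_fail _ _ _ _) ?_ key).trans (le_of_eq ?_)
      · refine Integrable.of_bound (C := 4 ^ (q.length + 1) * (13 / 16) ^ T)
          (Measurable.ite (measurableSet_le (measurable_pi_apply _) measurable_const)
            measurable_const measurable_const).aestronglyMeasurable
          (Eventually.of_forall fun η => ?_)
        rw [Real.norm_of_nonneg (by positivity)]
        split_ifs
        · gcongr <;> norm_num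
        · exact le_rfl
      -- Source of the constant: 1/4 · 1/4 + 3/4 = 13/16.
      · rw [integral_ite_le, SimpleGraph.Walk.length_cons]
        ring

/-- Union bound over the targets. Twenty rounds per unit of distance suffice because 4 · (13/16)^20
< 1/10. -/
lemma fail_le_of_dist {V : Type*} [Finite V] {G : SimpleGraph V}
    (hdeg : ∀ u, (G.neighborSet u).ncard ≤ 4) (hG : G.Connected) {Z B : Set V} {D : ℕ}
    (hB : ∀ w ∈ B, ∃ z ∈ Z, G.dist z w ≤ D) :
    fail G Z B (20 * D) ≤ Nat.card V * (1 / 10) ^ D := by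
  classical
  cases nonempty_fintype V
  have h1 : ∀ w ∈ B.toFinite.toFinset, fail G Z {w} (20 * D) ≤ (1 / 10) ^ D := by
    intro w hw
    obtain ⟨z, hz, hd⟩ := hB w (by simpa using hw)
    obtain ⟨p, hp⟩ := hG.exists_walk_length_eq_dist z w
    refine (fail_le_of_walk hdeg _ hz p).trans ?_
    calc (4 : ℝ) ^ p.length * (13 / 16) ^ (20 * D) ≤ 4 ^ D * ((13 / 16) ^ 20) ^ D := by
          rw [hp, pow_mul]
          gcongr
          norm_num
      _ = (4 * (13 / 16) ^ 20) ^ D := by rw [mul_pow]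
      _ ≤ _ := by gcongr; norm_num
  calc fail G Z B (20 * D) ≤ fail G Z (⋃ w ∈ B.toFinite.toFinset, {w}) (20 * D) :=
        fail_mono subset_rfl (fun w hw => by simpa using hw) _
    _ ≤ ∑ w ∈ B.toFinite.toFinset, fail G Z {w} (20 * D) := fail_biUnion_le _ _ _ _
    _ ≤ ∑ w ∈ B.toFinite.toFinset, (1 / 10) ^ D := Finset.sum_le_sum h1
    _ ≤ _ := by
        rw [Finset.sum_const, nsmul_eq_mul]
        gcongr
        rw [Nat.card_eq_fintype_card]
        exact Finset.card_le_univ _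

/-! ### Finite Markov chains: convergence and the Poisson equation. -/

section FiniteChain

variable {S : Type*} [Fintype S]

/-- `P` has nonnegative entries and rows of sum one. -/
def IsTransition (P : Matrix S S ℝ) : Prop := (∀ x y, 0 ≤ P x y) ∧ ∀ x, ∑ y, P x y = 1

lemma IsTransition.mulVec_mem_Icc {P : Matrix S S ℝ} (hP : IsTransition P) {f : S → ℝ} {a b : ℝ}
    (hf : ∀ x, f x ∈ Set.Icc a b) (x : S) : P.mulVec f x ∈ Set.Icc a b := by
  have h1 : ∀ c : ℝ, c = ∑ y, P x y * c := fun c => by rw [← Finset.sum_mul, hP.2, one_mul]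
  constructor
  · rw [h1 a]
    exact Finset.sum_le_sum fun y _ => mul_le_mul_of_nonneg_left (hf y).1 (hP.1 x y)
  · rw [h1 b]
    exact Finset.sum_le_sum fun y _ => mul_le_mul_of_nonneg_left (hf y).2 (hP.1 x y)

/-- Every row gives `w` mass at least `c`, so every average is pulled towards `f w`. The interval
shrinks by the factor `1 - c`, wherever `f w` lies. -/
lemma IsTransition.mulVec_contract {Q : Matrix S S ℝ} (hQ : IsTransition Q) {w : S} {c : ℝ}
    (hw : ∀ x, c ≤ Q x w) {f : S → ℝ} {a b : ℝ} (hf : ∀ x, f x ∈ Set.Icc a b) (x : S) :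
    Q.mulVec f x ∈ Set.Icc (a + c * (f w - a)) (b - c * (b - f w)) := by
  have h1 : ∀ e : ℝ, Q.mulVec f x = e + ∑ y, Q x y * (f y - e) := fun e => by
    simp_rw [mul_sub, Finset.sum_sub_distrib]
    rw [← Finset.sum_mul, hQ.2, one_mul]
    simp [Matrix.mulVec, dotProduct]
  constructor
  · rw [h1 a]
    have h2 : Q x w * (f w - a) ≤ ∑ y, Q x y * (f y - a) :=
      Finset.single_le_sum (f := fun y => Q x y * (f y - a))
        (fun y _ => mul_nonneg (hQ.1 x y) (sub_nonneg.2 (hf y).1)) (Finset.mem_univ w)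
    nlinarith [mul_le_mul_of_nonneg_right (hw x) (sub_nonneg.2 (hf w).1)]
  · rw [h1 b]
    have h2 : Q x w * (b - f w) ≤ ∑ y, Q x y * (b - f y) :=
      Finset.single_le_sum (f := fun y => Q x y * (b - f y))
        (fun y _ => mul_nonneg (hQ.1 x y) (sub_nonneg.2 (hf y).2)) (Finset.mem_univ w)
    have h3 : ∑ y, Q x y * (f y - b) = - ∑ y, Q x y * (b - f y) := by
      rw [← Finset.sum_neg_distrib]
      exact Finset.sum_congr rfl fun y _ => by ring
    rw [h3]
    nlinarith [mul_le_mul_of_nonneg_right (hw x) (sub_nonneg.2 (hf w).2)]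

variable [DecidableEq S]

lemma IsTransition.pow {P : Matrix S S ℝ} (hP : IsTransition P) (t : ℕ) : IsTransition (P ^ t) := by
  induction t with
  | zero =>
    refine ⟨fun x y => ?_, fun x => ?_⟩
    · rw [pow_zero, Matrix.one_apply]
      split_ifs <;> norm_num
    · simp [Matrix.one_apply]
  | succ t ih =>
    refine ⟨fun x y => ?_, fun x => ?_⟩
    · rw [pow_succ, Matrix.mul_apply]
      exact Finset.sum_nonneg fun z _ => mul_nonneg (ih.1 x z) (hP.1 z y)
    · simp_rw [pow_succ, Matrix.mul_apply]
      rw [Finset.sum_comm]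
      simp_rw [← Finset.mul_sum, hP.2, mul_one, ih.2]

/-- If some power of `P` has a column bounded below by `c > 0`, then the values of `P ^ t f` are
eventually confined to intervals of geometrically decreasing length. -/
lemma IsTransition.exists_Icc {P : Matrix S S ℝ} (hP : IsTransition P) {w : S} {m : ℕ} {c : ℝ}
    (hw : ∀ x, c ≤ (P ^ m) x w) {f : S → ℝ} {a b : ℝ} (hf : ∀ x, f x ∈ Set.Icc a b) (k : ℕ) :
    ∃ a' b', b' - a' ≤ (1 - c) ^ k * (b - a) ∧
      ∀ t x, (P ^ (t + m * k)).mulVec f x ∈ Set.Icc a' b' := by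
  induction k with
  | zero => exact ⟨a, b, by simp, fun t x => (hP.pow _).mulVec_mem_Icc hf x⟩
  | succ k ih =>
    obtain ⟨a', b', h1, h2⟩ := ih
    have hc : c ≤ 1 := by
      refine (hw w).trans ?_
      rw [← (hP.pow m).2 w]
      exact Finset.single_le_sum (f := fun y => (P ^ m) w y)
        (fun y _ => (hP.pow m).1 w y) (Finset.mem_univ w)
    set g := (P ^ (m * k)).mulVec f with hg
    have hg' : ∀ x, g x ∈ Set.Icc a' b' := fun x => by simpa using h2 0 x
    have h3 := (hP.pow m).mulVec_contract hw hg'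
    refine ⟨a' + c * (g w - a'), b' - c * (b' - g w), ?_, fun t x => ?_⟩
    rotate_left
    · have : (P ^ (t + m * (k + 1))).mulVec f = (P ^ t).mulVec ((P ^ m).mulVec g) := by
        rw [hg, Matrix.mulVec_mulVec, Matrix.mulVec_mulVec, ← pow_add, ← pow_add]
        congr 2
        ring
      rw [this]
      exact (hP.pow t).mulVec_mem_Icc h3 x
    · calc _ = (1 - c) * (b' - a') := by ring
        _ ≤ (1 - c) * ((1 - c) ^ k * (b - a)) :=
          mul_le_mul_of_nonneg_left h1 (sub_nonneg.2 hc)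
        _ = _ := by ring

/-- Doeblin's condition: the oscillation decays geometrically, so the values are Cauchy in time and
forget the initial state. -/
lemma IsTransition.exists_tendsto {P : Matrix S S ℝ} (hP : IsTransition P) {w : S} {m : ℕ} {c : ℝ}
    (hc : 0 < c) (hw : ∀ x, c ≤ (P ^ m) x w) (f : S → ℝ) :
    ∃ l : ℝ, ∀ x, Tendsto (fun t : ℕ => (P ^ t).mulVec f x) atTop (𝓝 l) := by
  obtain ⟨b, hb⟩ : ∃ b, ∀ x, |f x| ≤ b :=
    ⟨∑ x, |f x|, fun x => Finset.single_le_sum (f := fun x => |f x|)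
      (fun y _ => abs_nonneg _) (Finset.mem_univ x)⟩
  have hf : ∀ x, f x ∈ Set.Icc (-b) b := fun x => abs_le.1 (hb x)
  have hc1 : c ≤ 1 := by
    refine (hw w).trans ?_
    rw [← (hP.pow m).2 w]
    exact Finset.single_le_sum (f := fun y => (P ^ m) w y)
      (fun y _ => (hP.pow m).1 w y) (Finset.mem_univ w)
  have key : ∀ e > 0, ∃ N, ∀ s ≥ N, ∀ t ≥ N, ∀ x y,
      |(P ^ s).mulVec f x - (P ^ t).mulVec f y| < e := by
    intro e he
    have hlim : Tendsto (fun k : ℕ => (1 - c) ^ k * (b - -b)) atTop (𝓝 0) := by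
      simpa using (tendsto_pow_atTop_nhds_zero_of_lt_one (by linarith) (by linarith)).mul_const
        (b - -b)
    obtain ⟨k, hk⟩ := (hlim.eventually (gt_mem_nhds he)).exists
    obtain ⟨a', b', h1, h2⟩ := hP.exists_Icc hw hf k
    refine ⟨m * k, fun s hs t ht x y => ?_⟩
    have hx := h2 (s - m * k) x
    have hy := h2 (t - m * k) y
    rw [Nat.sub_add_cancel hs] at hx
    rw [Nat.sub_add_cancel ht] at hy
    rw [abs_lt]
    constructor <;> linarith [hx.1, hx.2, hy.1, hy.2]
  have hcauchy : CauchySeq fun t : ℕ => (P ^ t).mulVec f w := by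
    rw [Metric.cauchySeq_iff]
    intro e he
    obtain ⟨N, hN⟩ := key e he
    exact ⟨N, fun s hs t ht => hN s hs t ht w w⟩
  obtain ⟨l, hl⟩ := cauchySeq_tendsto_of_complete hcauchy
  refine ⟨l, fun x => ?_⟩
  have h0 : Tendsto (fun t : ℕ => (P ^ t).mulVec f x - (P ^ t).mulVec f w) atTop (𝓝 0) := by
    rw [Metric.tendsto_atTop]
    intro e he
    obtain ⟨N, hN⟩ := key e he
    exact ⟨N, fun t ht => by simpa using hN t ht t ht x w⟩
  simpa using h0.add hl

lemma IsTransition.exists_isStationary {P : Matrix S S ℝ} (hP : IsTransition P) {w : S} {m : ℕ}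
    {c : ℝ} (hc : 0 < c) (hw : ∀ x, c ≤ (P ^ m) x w) :
    ∃ π : S → ℝ, IsStationary P π ∧ IsLimiting P π := by
  choose π hπ using fun y => hP.exists_tendsto hc hw (Pi.single y 1)
  simp only [Matrix.mulVec_single_one] at hπ
  refine ⟨π, ⟨fun y => ?_, ?_, ?_⟩, fun x y => hπ y x⟩
  · exact ge_of_tendsto' (hπ y w) fun t => (hP.pow t).1 w y
  · refine tendsto_nhds_unique (tendsto_finsetSum Finset.univ fun y _ => hπ y w) ?_
    refine tendsto_const_nhds.congr fun t => ?_
    exact ((hP.pow t).2 w).symm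
  · ext y
    refine tendsto_nhds_unique ?_ ((hπ y w).comp (tendsto_add_atTop_nat 1))
    refine (tendsto_finsetSum Finset.univ fun z _ => (hπ z w).mul_const (P z y)).congr fun t => ?_
    simp [pow_succ, Matrix.mul_apply]

/-- The Poisson equation of a chain with a limiting distribution. -/
lemma exists_poisson {P : Matrix S S ℝ} {π : S → ℝ} (hs : IsStationary P π)
    (hl : IsLimiting P π) {f : S → ℝ} (hf : ∑ x, π x * f x = 0) :
    ∃ h : S → ℝ, ∀ x, f x + ∑ y, P x y * h y = h x := by
  set A : (S → ℝ) →ₗ[ℝ] (S → ℝ) := LinearMap.id - P.mulVecLin with hA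
  set φ : (S → ℝ) →ₗ[ℝ] ℝ := Fintype.linearCombination ℝ π with hφ
  have hφa : ∀ g, φ g = ∑ x, π x * g x := fun g => by
    rw [hφ, Fintype.linearCombination_apply]
    exact Finset.sum_congr rfl fun x _ => by rw [smul_eq_mul, mul_comm]
  have hφ1 : φ (fun _ => 1) = 1 := by rw [hφa]; simpa using hs.2.1
  -- A harmonic function is fixed by all powers of `P`, hence equals its limit, which is constant.
  have hker : LinearMap.ker A ≤ Submodule.span ℝ {fun _ : S => (1 : ℝ)} := by
    intro g hg
    have hg' : P.mulVec g = g := by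
      have := LinearMap.mem_ker.1 hg
      rw [hA, LinearMap.sub_apply, sub_eq_zero] at this
      exact this.symm
    have hpow : ∀ t : ℕ, (P ^ t).mulVec g = g := by
      intro t
      induction t with
      | zero => simp
      | succ t ih => rw [pow_succ, ← Matrix.mulVec_mulVec, hg', ih]
    refine Submodule.mem_span_singleton.2 ⟨φ g, ?_⟩
    ext x
    have h1 : Tendsto (fun t : ℕ => (P ^ t).mulVec g x) atTop (𝓝 (∑ y, π y * g y)) :=
      tendsto_finsetSum Finset.univ fun y _ => (hl x y).mul_const (g y)
    simp_rw [hpow] at h1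
    rw [Pi.smul_apply, smul_eq_mul, mul_one, hφa]
    exact tendsto_nhds_unique h1 tendsto_const_nhds
  have hle : LinearMap.range A ≤ LinearMap.ker φ := by
    rintro _ ⟨g, rfl⟩
    have h1 : ∑ x, π x * P.mulVec g x = ∑ x, π x * g x := by
      have := Matrix.dotProduct_mulVec π P g
      rw [hs.2.2] at this
      exact this
    rw [LinearMap.mem_ker, hA, LinearMap.sub_apply, map_sub, hφa, hφa, LinearMap.id_apply,
      Matrix.mulVecLin_apply, h1, sub_self]
  have h1 := LinearMap.finrank_range_add_finrank_ker A
  have h2 := LinearMap.finrank_range_add_finrank_ker φ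
  have h3 : Module.finrank ℝ (LinearMap.ker A) ≤ 1 :=
    (Submodule.finrank_mono hker).trans ((finrank_span_le_card _).trans (by simp))
  have h4 : 1 ≤ Module.finrank ℝ (LinearMap.range φ) := by
    rw [Nat.one_le_iff_ne_zero, Ne, Submodule.finrank_eq_zero, LinearMap.range_eq_bot]
    intro h0
    rw [h0] at hφ1
    simp at hφ1
  -- By rank-nullity, `range A` has codimension at most 1 and `ker φ` at least 1, so the inclusion
  -- is an equality.
  have heq := Submodule.eq_of_le_of_finrank_le hle (by omega)
  have hmem : f ∈ LinearMap.range A := by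
    rw [heq, LinearMap.mem_ker, hφa, hf]
  obtain ⟨h, hh⟩ := hmem
  refine ⟨h, fun x => ?_⟩
  have := congrFun hh x
  simp only [hA, LinearMap.sub_apply, LinearMap.id_apply, Matrix.mulVecLin_apply, Pi.sub_apply]
    at this
  rw [← this]
  simp [Matrix.mulVec, dotProduct]

end FiniteChain

/-! ### The window chain driven by noise; its stationary distribution. -/

section NoiseRepresentation

variable {d : ℕ}

/-- Whether the next window is `(u 0, …, u (d - 1))` when the next diagonal has the colours `U` and
`b` decides ties. -/
def PicksInit (U : Config (d + 1)) (b : Bool) : Prop :=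
  blueCount (Fin.tail U : Config d) < blueCount (Fin.init U : Config d) ∨
    blueCount (Fin.init U : Config d) = blueCount (Fin.tail U : Config d) ∧ b = true

instance (U : Config (d + 1)) (b : Bool) : Decidable (PicksInit U b) := by
  unfold PicksInit; infer_instance

/-- The configuration after the all white one, `b` deciding between the central positions. -/
def resetConfig (d : ℕ) (b : Bool) : Config d :=
  if d = 2 then allBlue d
  else if Odd d then threeBlue d ((d - 3) / 2)
  else if b then threeBlue d ((d - 4) / 2) else threeBlue d ((d - 2) / 2)

/-- The next configuration as a function of independent noise. -/
def nextConfig (C : Config d) (x : Config (d + 1) × Bool) : Config d :=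
  if C = allWhite d then resetConfig d x.2
  else if PicksInit x.1 x.2 then Fin.init x.1 else Fin.tail x.1

/-- The position of some blue vertex of the configuration. -/
def someBlue (C : Config d) : ℤ :=
  open Classical in if h : ∃ i, C i = true then ((h.choose : ℕ) : ℤ) else 0

/-- A choice of one blue position for each value of `b`, equivariant under reflection. -/
def pickBlue (C : Config d) (b : Bool) : ℤ :=
  if b then someBlue C else d - 1 - someBlue (C ∘ Fin.rev)

/-- Twice the displacement of the centre of the window relative to the diagonal direction. -/
def shift (C : Config d) (x : Config (d + 1) × Bool) : ℤ :=
  if C = allWhite d then (if Odd d then 0 else if x.2 then 1 else -1)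
  else if x.1 = allWhite (d + 1) then 2 * pickBlue C x.2 - (d - 1)
  else if PicksInit x.1 x.2 then -1 else 1

/-- The law of the noise. -/
def noiseProb (C : Config d) (x : Config (d + 1) × Bool) : ℝ := diagProb C x.1 / 2

lemma turnBlueProb_mem_Icc (C : Config d) (k : Fin (d + 1)) : turnBlueProb C k ∈ Set.Icc (0 : ℝ) 1 := by
  unfold turnBlueProb
  have h1 : (0 : ℝ) ≤ (1 / 4) ^ blueNbrs C k := by positivity
  have h2 : ((1 : ℝ) / 4) ^ blueNbrs C k ≤ 1 := pow_le_one₀ (by norm_num) (by norm_num)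
  constructor <;> linarith

lemma diagProb_nonneg (C : Config d) (U : Config (d + 1)) : 0 ≤ diagProb C U := by
  refine Finset.prod_nonneg fun k _ => ?_
  have := turnBlueProb_mem_Icc C k
  split_ifs
  · exact this.1
  · exact sub_nonneg.2 this.2

lemma sum_diagProb (C : Config d) : ∑ U, diagProb C U = 1 := by
  have := Finset.prod_univ_sum (fun _ : Fin (d + 1) => (Finset.univ : Finset Bool))
    (fun k b => if b = true then turnBlueProb C k else 1 - turnBlueProb C k)
  simp only [Fintype.univ_bool, Finset.mem_singleton, Bool.true_eq_false, not_false_eq_true,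
    Finset.sum_insert, Finset.sum_singleton, if_true, Bool.false_eq_true, if_false,
    add_sub_cancel, Finset.prod_const_one] at this
  rw [this]
  refine Finset.sum_congr ?_ fun _ _ => rfl
  ext U
  simp [Fintype.mem_piFinset]

lemma noiseProb_nonneg (C : Config d) (x : Config (d + 1) × Bool) : 0 ≤ noiseProb C x :=
  div_nonneg (diagProb_nonneg _ _) (by norm_num)

lemma sum_noiseProb_mul (C : Config d) (g : Config (d + 1) × Bool → ℝ) :
    ∑ x, noiseProb C x * g x = ∑ U, diagProb C U * ((g (U, true) + g (U, false)) / 2) := by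
  rw [Fintype.sum_prod_type]
  refine Finset.sum_congr rfl fun U _ => ?_
  simp only [Fintype.sum_bool, noiseProb]
  ring

lemma sum_noiseProb (C : Config d) : ∑ x, noiseProb C x = 1 := by
  have := sum_noiseProb_mul C fun _ => 1
  simpa [sum_diagProb] using this

/-- The single bit of the noise serves both ties and the even reset; averaging over it produces the
coefficients 1/2. -/
lemma windowChain_eq_sum_noise (C C' : Config d) :
    windowChain d C C' = ∑ x, noiseProb C x * if nextConfig C x = C' then 1 else 0 := by
  rw [sum_noiseProb_mul]
  by_cases hC : C = allWhite d
  · rw [windowChain, if_pos hC]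
    simp only [nextConfig, if_pos hC]
    rw [← Finset.sum_mul, sum_diagProb, one_mul]
    simp only [resetConfig, resetProb, eq_comm (a := C')]
    split_ifs <;> (simp_all; try norm_num)
  · rw [windowChain, if_neg hC]
    refine Finset.sum_congr rfl fun U _ => ?_
    congr 1
    simp only [nextConfig, if_neg hC, selectProb, PicksInit, eq_comm (a := C')]
    rcases lt_trichotomy (blueCount (Fin.init U : Config d)) (blueCount (Fin.tail U : Config d))
      with h | h | h
    · have h1 := h.ne
      have h2 := h.not_gt
      simp [h, h1, h2]
    · simp only [h, lt_irrefl, if_false, false_or, true_and, if_true, Bool.false_eq_true]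
      ring
    · have h1 := h.ne'
      simp [h, h1]

lemma sum_windowChain_mul (C : Config d) (g : Config d → ℝ) :
    ∑ C', windowChain d C C' * g C' = ∑ x, noiseProb C x * g (nextConfig C x) := by
  simp_rw [windowChain_eq_sum_noise, Finset.sum_mul]
  rw [Finset.sum_comm]
  refine Finset.sum_congr rfl fun x _ => ?_
  simp [ite_mul]

lemma isTransition_windowChain : IsTransition (windowChain d) := by
  refine ⟨fun C C' => ?_, fun C => ?_⟩
  · rw [windowChain_eq_sum_noise]
    refine Finset.sum_nonneg fun x _ => mul_nonneg (noiseProb_nonneg _ _) ?_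
    split_ifs <;> norm_num
  · have := sum_windowChain_mul C fun _ => 1
    simpa [sum_noiseProb] using this

lemma ne_allWhite_iff {C : Config d} : C ≠ allWhite d ↔ ∃ i, C i = true := by
  rw [Function.ne_iff]
  simp [allWhite]

lemma blueCount_pos {C : Config d} (i : Fin d) (h : C i = true) : 0 < blueCount C :=
  Finset.card_pos.2 ⟨i, by simpa using h⟩

lemma blueCount_allWhite : blueCount (allWhite d) = 0 := by simp [blueCount, allWhite]

lemma nextConfig_ne_allWhite {C : Config d} (hd : 2 ≤ d) (hC : C ≠ allWhite d)
    {U : Config (d + 1)} (hU : U ≠ allWhite (d + 1)) (b : Bool) :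
    nextConfig C (U, b) ≠ allWhite d := by
  intro h
  have h0 : blueCount (nextConfig C (U, b)) = 0 := by rw [h, blueCount_allWhite]
  rw [nextConfig, if_neg hC] at h0
  have hmax : blueCount (Fin.init U : Config d) = 0 ∧ blueCount (Fin.tail U : Config d) = 0 := by
    by_cases hp : PicksInit U b
    · have h1 : blueCount (Fin.init U : Config d) = 0 := by rwa [if_pos hp] at h0
      unfold PicksInit at hp
      omega
    · have h1 : blueCount (Fin.tail U : Config d) = 0 := by rwa [if_neg hp] at h0
      unfold PicksInit at hp
      omega
  obtain ⟨i, hi⟩ := ne_allWhite_iff.1 hU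
  rcases Fin.eq_zero_or_eq_succ i with rfl | ⟨j, rfl⟩
  · have := blueCount_pos (C := (Fin.init U : Config d)) ⟨0, by omega⟩ hi
    omega
  · have := blueCount_pos (C := (Fin.tail U : Config d)) j hi
    omega

lemma nextConfig_allWhite {C : Config d} (hC : C ≠ allWhite d) (b : Bool) :
    nextConfig C (allWhite (d + 1), b) = allWhite d := by
  simp only [nextConfig, if_neg hC]
  split_ifs <;> rfl

lemma windowChain_allWhite (hd : 2 ≤ d) {C : Config d} (hC : C ≠ allWhite d) :
    windowChain d C (allWhite d) = (1 / 4) ^ ∑ k, blueNbrs C k := by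
  rw [windowChain_eq_sum_noise, sum_noiseProb_mul, Finset.sum_eq_single (allWhite (d + 1))]
  · simp only [nextConfig_allWhite hC]
    simp [diagProb, allWhite, turnBlueProb, Finset.prod_pow_eq_pow_sum]
  · intro U _ hU
    simp [nextConfig_ne_allWhite hd hC hU]
  · simp

/-- Each blue vertex is adjacent to exactly two vertices of the next diagonal. -/
lemma two_le_sum_blueNbrs {C : Config d} (hC : C ≠ allWhite d) : 2 ≤ ∑ k, blueNbrs C k := by
  obtain ⟨i, hi⟩ := ne_allWhite_iff.1 hC
  have h1 : ∑ k, blueNbrs C k = ∑ i, (C i).toNat + ∑ i, (C i).toNat := by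
    simp only [blueNbrs, Finset.sum_add_distrib]
    rw [Fin.sum_univ_succ, Fin.sum_univ_castSucc (n := d)
      (f := fun k => (Fin.snoc C false : Config (d + 1)) k |>.toNat)]
    simp
  have h2 : 1 ≤ ∑ i, (C i).toNat := by
    calc 1 = (C i).toNat := by simp [hi]
      _ ≤ _ := Finset.single_le_sum (f := fun i => (C i).toNat) (fun _ _ => Nat.zero_le _)
        (Finset.mem_univ i)
  omega

lemma windowChain_allWhite_le (hd : 2 ≤ d) {C : Config d} (hC : C ≠ allWhite d) :
    windowChain d C (allWhite d) ≤ 1 / 16 := by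
  rw [windowChain_allWhite hd hC]
  calc ((1 : ℝ) / 4) ^ ∑ k, blueNbrs C k ≤ (1 / 4) ^ 2 :=
        pow_le_pow_of_le_one (by norm_num) (by norm_num) (two_le_sum_blueNbrs hC)
    _ = 1 / 16 := by norm_num

lemma resetConfig_ne_allWhite (hd : 2 ≤ d) (b : Bool) : resetConfig d b ≠ allWhite d := by
  rw [ne_allWhite_iff]
  unfold resetConfig
  split_ifs with h1 h2 h3
  · exact ⟨⟨0, by omega⟩, rfl⟩
  · obtain ⟨r, hr⟩ := h2
    exact ⟨⟨(d - 3) / 2, by omega⟩, by simp [threeBlue]⟩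
  · exact ⟨⟨(d - 4) / 2, by omega⟩, by simp [threeBlue]⟩
  · exact ⟨⟨(d - 2) / 2, by omega⟩, by simp [threeBlue]⟩

/-- Step to some state that is not all white, then let every attempt fail. One step would not do, as
the all white state never repeats immediately. -/
lemma windowChain_sq_pos (hd : 2 ≤ d) (C : Config d) :
    0 < (windowChain d ^ 2) C (allWhite d) := by
  have hT := isTransition_windowChain (d := d)
  have hle : windowChain d C (allWhite d) ≤ 1 / 16 := by
    by_cases hC : C = allWhite d
    · rw [windowChain_eq_sum_noise, Finset.sum_eq_zero]
      · norm_num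
      · intro x _
        rw [nextConfig, if_pos hC, if_neg (resetConfig_ne_allWhite hd _), mul_zero]
    · exact windowChain_allWhite_le hd hC
  obtain ⟨C', hC', hpos⟩ : ∃ C', C' ≠ allWhite d ∧ 0 < windowChain d C C' := by
    by_contra! hc
    have := hT.2 C
    rw [Finset.sum_eq_single (allWhite d) (fun C' _ h => le_antisymm (hc C' h) (hT.1 _ _))
      (by simp)] at this
    linarith
  rw [pow_two, Matrix.mul_apply]
  refine lt_of_lt_of_le ?_ (Finset.single_le_sum
    (f := fun z => windowChain d C z * windowChain d z (allWhite d))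
    (fun z _ => mul_nonneg (hT.1 _ _) (hT.1 _ _)) (Finset.mem_univ C'))
  refine mul_pos hpos ?_
  rw [windowChain_allWhite hd hC']
  positivity

lemma exists_isStationary_windowChain (hd : 2 ≤ d) :
    ∃ π : Config d → ℝ, IsStationary (windowChain d) π ∧ IsLimiting (windowChain d) π := by
  obtain ⟨C, -, hC⟩ := Finset.exists_min_image Finset.univ
    (fun C => (windowChain d ^ 2) C (allWhite d)) Finset.univ_nonempty
  exact isTransition_windowChain.exists_isStationary (windowChain_sq_pos hd C)
    fun x => hC x (Finset.mem_univ x)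

/-- All white is entered only from other states, each time with probability at most 1/16, so its
stationary mass is at most 1/16. -/
lemma stationary_allWhite_lt (hd : 2 ≤ d) {π : Config d → ℝ}
    (hπ : IsStationary (windowChain d) π) : π (allWhite d) < 1 / 2 := by
  have h1 := congrFun hπ.2.2 (allWhite d)
  have h2 : π (allWhite d) ≤ ∑ C, (if C = allWhite d then 0 else π C) * (1 / 16) := by
    rw [← h1]
    refine Finset.sum_le_sum fun C _ => ?_
    change π C * windowChain d C (allWhite d) ≤ _
    split_ifs with hC
    · rw [windowChain_eq_sum_noise, Finset.sum_eq_zero]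
      · simp
      · intro x _
        rw [nextConfig, if_pos hC, if_neg (resetConfig_ne_allWhite hd _), mul_zero]
    · exact mul_le_mul_of_nonneg_left (windowChain_allWhite_le hd hC) (hπ.1 C)
  have h3 : ∑ C, (if C = allWhite d then 0 else π C) ≤ 1 := by
    rw [← hπ.2.1]
    refine Finset.sum_le_sum fun C _ => ?_
    split_ifs
    · exact hπ.1 C
    · exact le_rfl
  rw [← Finset.sum_mul] at h2
  linarith

end NoiseRepresentation

/-! ### Reflection symmetry and vanishing transversal drift. -/

section Reflection

variable {d : ℕ}

/-- Reflection of the noise. -/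
def noiseRev : Config (d + 1) × Bool ≃ Config (d + 1) × Bool :=
  (Equiv.arrowCongr Fin.revPerm (Equiv.refl Bool)).prodCongr Equiv.boolNot

lemma noiseRev_apply (U : Config (d + 1)) (b : Bool) : noiseRev (U, b) = (U ∘ Fin.rev, !b) := rfl

lemma comp_rev_eq_allWhite {C : Config d} : C ∘ Fin.rev = allWhite d ↔ C = allWhite d := by
  constructor
  · intro h
    ext i
    have := congrFun h (Fin.rev i)
    rwa [Function.comp_apply, Fin.rev_rev] at this
  · rintro rfl
    rfl

lemma blueNbrs_rev (C : Config d) (k : Fin (d + 1)) :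
    blueNbrs (C ∘ Fin.rev) k = blueNbrs C (Fin.rev k) := by
  unfold blueNbrs
  have h1 := congrFun (Fin.cons_comp_rev (α := Bool) (a := false) (f := C)) k
  have h2 := congrFun (Fin.snoc_comp_rev (α := Bool) (a := false) (f := C)) k
  simp only [Function.comp_apply] at h1 h2
  rw [h1, h2, add_comm]

lemma diagProb_rev (C : Config d) (U : Config (d + 1)) :
    diagProb (C ∘ Fin.rev) (U ∘ Fin.rev) = diagProb C U := by
  unfold diagProb turnBlueProb
  simp only [blueNbrs_rev, Function.comp_apply]
  exact Equiv.prod_comp Fin.revPerm fun k =>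
    if U k = true then 1 - (1 / 4 : ℝ) ^ blueNbrs C k else 1 - (1 - (1 / 4) ^ blueNbrs C k)

lemma init_rev (U : Config (d + 1)) :
    (Fin.init (U ∘ Fin.rev) : Config d) = (Fin.tail U : Config d) ∘ Fin.rev := by
  ext i
  simp [Fin.init, Fin.tail, Fin.rev_castSucc]

lemma tail_rev (U : Config (d + 1)) :
    (Fin.tail (U ∘ Fin.rev) : Config d) = (Fin.init U : Config d) ∘ Fin.rev := by
  ext i
  simp [Fin.init, Fin.tail, Fin.rev_succ]

lemma blueCount_rev (C : Config d) : blueCount (C ∘ Fin.rev) = blueCount C := by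
  unfold blueCount
  refine Finset.card_equiv Fin.revPerm fun i => ?_
  simp

/-- Reflection exchanges the two candidate windows; negating the bit makes tie-breaking equivariant
too. -/
lemma picksInit_rev (U : Config (d + 1)) (b : Bool) :
    PicksInit (U ∘ Fin.rev) (!b) ↔ ¬ PicksInit U b := by
  unfold PicksInit
  rw [init_rev, tail_rev, blueCount_rev, blueCount_rev]
  cases b <;> simp <;> omega

lemma resetConfig_not (hd : 2 ≤ d) (b : Bool) :
    resetConfig d (!b) = resetConfig d b ∘ Fin.rev := by
  unfold resetConfig
  split_ifs with h1 h2 h3 h4 h5 <;> try rfl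
  · obtain ⟨r, hr⟩ := h2
    ext i
    simp only [threeBlue, Function.comp_apply, Fin.val_rev]
    have := i.2
    rw [decide_eq_decide]
    omega
  · simp_all
  · have := Nat.not_odd_iff_even.1 h2
    obtain ⟨r, hr⟩ := this
    ext i
    simp only [threeBlue, Function.comp_apply, Fin.val_rev]
    have := i.2
    rw [decide_eq_decide]
    omega
  · have := Nat.not_odd_iff_even.1 h2
    obtain ⟨r, hr⟩ := this
    ext i
    simp only [threeBlue, Function.comp_apply, Fin.val_rev]
    have := i.2
    rw [decide_eq_decide]
    omega
  · simp_all

lemma nextConfig_rev (hd : 2 ≤ d) (C : Config d) (x : Config (d + 1) × Bool) :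
    nextConfig (C ∘ Fin.rev) (noiseRev x) = nextConfig C x ∘ Fin.rev := by
  obtain ⟨U, b⟩ := x
  rw [noiseRev_apply]
  simp only [nextConfig, comp_rev_eq_allWhite, picksInit_rev]
  split_ifs
  · exact resetConfig_not hd b
  · rw [tail_rev]
  · rw [init_rev]

lemma pickBlue_rev (C : Config d) (b : Bool) :
    pickBlue (C ∘ Fin.rev) (!b) = d - 1 - pickBlue C b := by
  have h : (C ∘ Fin.rev) ∘ Fin.rev = C := by ext i; simp
  cases b <;> simp [pickBlue, h]

lemma shift_rev (C : Config d) (x : Config (d + 1) × Bool) :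
    shift (C ∘ Fin.rev) (noiseRev x) = - shift C x := by
  obtain ⟨U, b⟩ := x
  rw [noiseRev_apply]
  simp only [shift, comp_rev_eq_allWhite, picksInit_rev, pickBlue_rev]
  split_ifs <;> (simp_all; try ring)

lemma noiseProb_rev (C : Config d) (x : Config (d + 1) × Bool) :
    noiseProb (C ∘ Fin.rev) (noiseRev x) = noiseProb C x := by
  obtain ⟨U, b⟩ := x
  rw [noiseRev_apply]
  simp only [noiseProb, diagProb_rev]

lemma windowChain_rev (hd : 2 ≤ d) (C C' : Config d) :
    windowChain d (C ∘ Fin.rev) (C' ∘ Fin.rev) = windowChain d C C' := by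
  have h : ∀ C'' : Config d, C'' ∘ Fin.rev = C' ∘ Fin.rev ↔ C'' = C' := fun C'' =>
    (Fin.rev_surjective.injective_comp_right).eq_iff
  rw [windowChain_eq_sum_noise, windowChain_eq_sum_noise, ← Equiv.sum_comp noiseRev]
  simp only [noiseProb_rev, nextConfig_rev hd, h]

/-- Reflection as a permutation of the configurations. -/
def revConfig : Config d ≃ Config d := Equiv.arrowCongr Fin.revPerm (Equiv.refl Bool)

lemma revConfig_apply (C : Config d) : revConfig C = C ∘ Fin.rev := rfl

lemma windowChain_pow_rev (hd : 2 ≤ d) (t : ℕ) (C C' : Config d) :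
    (windowChain d ^ t) (C ∘ Fin.rev) (C' ∘ Fin.rev) = (windowChain d ^ t) C C' := by
  induction t generalizing C C' with
  | zero =>
    simp only [pow_zero, Matrix.one_apply, (Fin.rev_surjective.injective_comp_right).eq_iff]
  | succ t ih =>
    rw [pow_succ, Matrix.mul_apply, Matrix.mul_apply, ← Equiv.sum_comp revConfig]
    simp only [revConfig_apply, ih, windowChain_rev hd]

lemma limiting_rev (hd : 2 ≤ d) {π : Config d → ℝ} (hl : IsLimiting (windowChain d) π)
    (C : Config d) : π (C ∘ Fin.rev) = π C := by
  refine tendsto_nhds_unique (hl (allWhite d ∘ Fin.rev) _) ?_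
  simp_rw [windowChain_pow_rev hd]
  exact hl _ _

/-- The expected shift has mean zero under the limiting distribution. -/
lemma sum_limiting_mul_shift (hd : 2 ≤ d) {π : Config d → ℝ}
    (hl : IsLimiting (windowChain d) π) :
    ∑ C, π C * ∑ x, noiseProb C x * (shift C x : ℝ) = 0 := by
  have h1 : ∀ C : Config d, ∑ x, noiseProb (C ∘ Fin.rev) x * (shift (C ∘ Fin.rev) x : ℝ) =
      - ∑ x, noiseProb C x * (shift C x : ℝ) := fun C => by
    rw [← Equiv.sum_comp noiseRev, ← Finset.sum_neg_distrib]
    simp [noiseProb_rev, shift_rev]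
  have h2 := Equiv.sum_comp revConfig
    fun C => π C * ∑ x, noiseProb C x * (shift C x : ℝ)
  simp only [revConfig_apply, limiting_rev hd hl, h1, mul_neg, Finset.sum_neg_distrib] at h2
  linarith

end Reflection

/-! ### Correctors for level and transversal coordinate. -/

section Poisson

variable {d : ℕ}

/-- The level increment of the window during a step of the chain. -/
def levelStep (C : Config d) : ℤ := if C = allWhite d then -1 else 1

/-- The number of rounds that a step of the chain takes. -/
def timeStep (C : Config d) : ℕ := if C = allWhite d then 0 else 1

/-- `γ` is the value that centres the increment: its stationary mean is `(1 - μ) - μ - γ (1 - μ) =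
0`. -/
lemma exists_level_corrector (hd : 2 ≤ d) {π : Config d → ℝ}
    (hs : IsStationary (windowChain d) π) (hl : IsLimiting (windowChain d) π) {γ : ℝ}
    (hγ : γ = (1 - 2 * π (allWhite d)) / (1 - π (allWhite d))) :
    ∃ h : Config d → ℝ, ∀ C,
      ∑ x, noiseProb C x * (levelStep C - γ * timeStep C + h (nextConfig C x)) = h C := by
  have hμ := stationary_allWhite_lt hd hs
  obtain ⟨h, hh⟩ := exists_poisson hs hl
    (f := fun C => (levelStep C : ℝ) - γ * timeStep C) (by
      have h1 : ∀ C, π C * ((levelStep C : ℝ) - γ * timeStep C) =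
          π C * (1 - γ) + if C = allWhite d then π C * (γ - 2) else 0 := fun C => by
        unfold levelStep timeStep
        split_ifs <;> simp <;> ring
      simp_rw [h1, Finset.sum_add_distrib, ← Finset.sum_mul, hs.2.1]
      rw [Finset.sum_ite_eq']
      simp only [Finset.mem_univ, if_true]
      rw [hγ]
      have : 1 - π (allWhite d) ≠ 0 := by linarith
      field_simp
      ring)
  refine ⟨h, fun C => ?_⟩
  rw [← hh C, sum_windowChain_mul]
  simp_rw [mul_add, Finset.sum_add_distrib, ← Finset.sum_mul, sum_noiseProb, one_mul]

lemma exists_shift_corrector (hd : 2 ≤ d) {π : Config d → ℝ}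
    (hs : IsStationary (windowChain d) π) (hl : IsLimiting (windowChain d) π) :
    ∃ h : Config d → ℝ, ∀ C, ∑ x, noiseProb C x * (shift C x + h (nextConfig C x)) = h C := by
  obtain ⟨h, hh⟩ := exists_poisson hs hl
    (sum_limiting_mul_shift hd hl)
  refine ⟨h, fun C => ?_⟩
  rw [← hh C, sum_windowChain_mul]
  simp_rw [mul_add, Finset.sum_add_distrib]

end Poisson

/-! ### Lattice charts and blue cones. -/

section Chart

variable {V : Type*} {G : SimpleGraph V}

/-- `φ` identifies the square `[lo - 1, hi + 1]²` of the square lattice with a set of vertices of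
`G`, and all neighbours of the vertices of `[lo, hi]²` are the neighbours in the lattice. -/
structure IsChart (G : SimpleGraph V) (φ : ℤ → ℤ → V) (lo hi : ℤ) : Prop where
  inj : ∀ i j i' j', lo - 1 ≤ i → i ≤ hi + 1 → lo - 1 ≤ j → j ≤ hi + 1 →
    lo - 1 ≤ i' → i' ≤ hi + 1 → lo - 1 ≤ j' → j' ≤ hi + 1 → φ i j = φ i' j' → i = i' ∧ j = j'
  nbrs : ∀ i j, lo ≤ i → i ≤ hi → lo ≤ j → j ≤ hi →
    G.neighborSet (φ i j) = {φ (i + 1) j, φ (i - 1) j, φ i (j + 1), φ i (j - 1)}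

variable {φ : ℤ → ℤ → V} {lo hi : ℤ}

lemma IsChart.swap (h : IsChart G φ lo hi) : IsChart G (fun i j => φ j i) lo hi where
  inj i j i' j' h1 h2 h3 h4 h1' h2' h3' h4' he :=
    (h.inj j i j' i' h3 h4 h1 h2 h3' h4' h1' h2' he).symm
  nbrs i j h1 h2 h3 h4 := by
    rw [h.nbrs j i h3 h4 h1 h2]
    ext x
    simp only [Set.mem_insert_iff, Set.mem_singleton_iff]
    tauto

lemma IsChart.eq_iff (h : IsChart G φ lo hi) {i j i' j' : ℤ} (h1 : lo - 1 ≤ i) (h2 : i ≤ hi + 1)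
    (h3 : lo - 1 ≤ j) (h4 : j ≤ hi + 1) (h1' : lo - 1 ≤ i') (h2' : i' ≤ hi + 1)
    (h3' : lo - 1 ≤ j') (h4' : j' ≤ hi + 1) : φ i j = φ i' j' ↔ i = i' ∧ j = j' :=
  ⟨h.inj i j i' j' h1 h2 h3 h4 h1' h2' h3' h4', fun h => by rw [h.1, h.2]⟩

lemma IsChart.ncard_neighborSet (h : IsChart G φ lo hi) {i j : ℤ} (h1 : lo ≤ i) (h2 : i ≤ hi)
    (h3 : lo ≤ j) (h4 : j ≤ hi) : (G.neighborSet (φ i j)).ncard ≤ 4 := by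
  rw [h.nbrs i j h1 h2 h3 h4]
  refine (Set.ncard_insert_le _ _).trans ?_
  refine (Nat.add_le_add_right (Set.ncard_insert_le _ _) 1).trans ?_
  refine (Nat.add_le_add_right (Nat.add_le_add_right (Set.ncard_insert_le _ _) 1) 1).trans ?_
  rw [Set.ncard_singleton]

lemma IsChart.adj_up (h : IsChart G φ lo hi) {i j : ℤ} (h1 : lo ≤ i) (h2 : i ≤ hi)
    (h3 : lo ≤ j) (h4 : j ≤ hi) : G.Adj (φ i j) (φ i (j + 1)) := by
  rw [← SimpleGraph.mem_neighborSet, h.nbrs i j h1 h2 h3 h4]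
  simp

variable [Finite V]

lemma IsChart.le_forceProb (h : IsChart G φ lo hi) {i j : ℤ} (h1 : lo ≤ i) (h2 : i ≤ hi)
    (h3 : lo ≤ j) (h4 : j ≤ hi) {Z : Set V} {m : ℕ}
    (hm : m ≤ (insert (φ i j) (G.neighborSet (φ i j)) ∩ Z).ncard) :
    (m : ℝ) / 4 ≤ forceProb G Z (φ i j) := by
  have hpos : 0 < (G.neighborSet (φ i j)).ncard :=
    (Set.ncard_pos).2 ⟨_, h.adj_up h1 h2 h3 h4⟩
  have hle : ((G.neighborSet (φ i j)).ncard : ℝ) ≤ 4 := by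
    exact_mod_cast h.ncard_neighborSet h1 h2 h3 h4
  have hm' : (m : ℝ) ≤ (insert (φ i j) (G.neighborSet (φ i j)) ∩ Z).ncard := by exact_mod_cast hm
  have hpos' : (0 : ℝ) < (G.neighborSet (φ i j)).ncard := by exact_mod_cast hpos
  unfold forceProb
  gcongr

lemma IsChart.three_quarters_le_forceProb (h : IsChart G φ lo hi) {i j : ℤ} (h1 : lo ≤ i)
    (h2 : i ≤ hi) (h3 : lo ≤ j) (h4 : j ≤ hi) {Z : Set V} (hZ : φ i j ∈ Z)
    (hl : φ (i - 1) j ∈ Z) (hd : φ i (j - 1) ∈ Z) : 3 / 4 ≤ forceProb G Z (φ i j) := by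
  have := h.le_forceProb (Z := Z) (m := 3) h1 h2 h3 h4 ?_
  · exact_mod_cast this
  have hsub : ({φ i j, φ (i - 1) j, φ i (j - 1)} : Set V) ⊆
      insert (φ i j) (G.neighborSet (φ i j)) ∩ Z := by
    rw [h.nbrs i j h1 h2 h3 h4]
    rintro x (rfl | rfl | rfl) <;> simp [hZ, hl, hd]
  refine le_trans (le_of_eq ?_) (Set.ncard_le_ncard hsub)
  symm
  rw [Set.ncard_eq_three]
  refine ⟨_, _, _, ?_, ?_, ?_, rfl⟩ <;>
    rw [Ne, h.eq_iff (by omega) (by omega) (by omega) (by omega) (by omega) (by omega) (by omega)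
      (by omega)] <;> omega

lemma IsChart.one_le_forceProb (h : IsChart G φ lo hi) {i j : ℤ} (h1 : lo ≤ i) (h2 : i ≤ hi)
    (h3 : lo ≤ j) (h4 : j ≤ hi) {Z : Set V} (hZ : φ i j ∈ Z) (hl : φ (i - 1) j ∈ Z)
    (hd : φ i (j - 1) ∈ Z) (hr : φ (i + 1) j ∈ Z) : 1 ≤ forceProb G Z (φ i j) := by
  have := h.le_forceProb (Z := Z) (m := 4) h1 h2 h3 h4 ?_
  · norm_num at this
    exact this
  have hsub : (insert (φ (i + 1) j) {φ i j, φ (i - 1) j, φ i (j - 1)} : Set V) ⊆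
      insert (φ i j) (G.neighborSet (φ i j)) ∩ Z := by
    rw [h.nbrs i j h1 h2 h3 h4]
    rintro x (rfl | rfl | rfl | rfl) <;> simp [hZ, hl, hd, hr]
  refine le_trans (le_of_eq ?_) (Set.ncard_le_ncard hsub)
  symm
  rw [Set.ncard_insert_of_notMem, Set.ncard_eq_three.2]
  · refine ⟨_, _, _, ?_, ?_, ?_, rfl⟩ <;>
    rw [Ne, h.eq_iff (by omega) (by omega) (by omega) (by omega) (by omega) (by omega) (by omega)
      (by omega)] <;> omega
  · simp only [Set.mem_insert_iff, Set.mem_singleton_iff]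
    rintro (h0 | h0 | h0) <;>
    rw [h.eq_iff (by omega) (by omega) (by omega) (by omega) (by omega) (by omega) (by omega)
      (by omega)] at h0 <;> omega

/-- The vertices of the band `|i - j| ≤ M` that are dominated by `(i, j)` and not below the
level `b` are all blue. -/
def ConeBlue (φ : ℤ → ℤ → V) (M b : ℤ) (Z : Set V) (i j : ℤ) : Prop :=
  ∀ i' j', i' ≤ i → j' ≤ j → i' - j' ≤ M → j' - i' ≤ M → b ≤ i' + j' → φ i' j' ∈ Z

variable {M b : ℤ} {Z : Set V}

omit [Finite V] in
lemma ConeBlue.mono {Z' : Set V} (hZ : Z ⊆ Z') {i j : ℤ} (h : ConeBlue φ M b Z i j) :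
    ConeBlue φ M b Z' i j :=
  fun i' j' h1 h2 h3 h4 h5 => hZ (h i' j' h1 h2 h3 h4 h5)

omit [Finite V] in
lemma ConeBlue.swap {i j : ℤ} (h : ConeBlue φ M b Z i j) :
    ConeBlue (fun i j => φ j i) M b Z j i :=
  fun i' j' h1 h2 h3 h4 h5 => h j' i' h2 h1 h4 h3 (by omega)

/-- One round certainly turns the row on top of a blue cone blue, except perhaps its end. -/
lemma ConeBlue.row (hφ : IsChart G φ lo hi) {i j : ℤ} (h : ConeBlue φ M b Z i j)
    (hlo : 2 * lo ≤ b - M) (hi1 : i + 1 ≤ hi) (hj1 : j + 1 ≤ hi) (hr : i - j + 2 ≤ M)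
    (hb : b + 2 * M + 4 ≤ i + j) (η : V × V → unitInterval) {i' j' : ℤ}
    (hi' : i' ≤ i) (hj' : j' ≤ j + 1) (hne : i' < i ∨ j' < j + 1) (hr' : i' - j' ≤ M)
    (hl' : j' - i' ≤ M) (hb' : b ≤ i' + j') : φ i' j' ∈ stepSet G Z η := by
  rcases lt_or_eq_of_le hj' with hlt | rfl
  · exact subset_stepSet _ _ (h i' j' hi' (by omega) hr' hl' hb')
  · refine Or.inr ⟨φ i' j, h _ _ hi' le_rfl (by omega) (by omega) (by omega),
      hφ.adj_up (by omega) (by omega) (by omega) (by omega), le_trans (η _).2.2 ?_⟩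
    -- The forcing vertex `(i', j)` and its left, lower and right neighbours lie in the cone. The
    -- margins `hr` and `hb` keep them inside the band and above level `b`.
    refine hφ.one_le_forceProb (by omega) (by omega) (by omega) (by omega) ?_ ?_ ?_ ?_ <;>
      exact h _ _ (by omega) (by omega) (by omega) (by omega) (by omega)

/-- Only the new tip needs luck; the rest of its row is certain. -/
lemma ConeBlue.up (hφ : IsChart G φ lo hi) {i j : ℤ} (h : ConeBlue φ M b Z i j)
    (hlo : 2 * lo ≤ b - M) (hi1 : i + 1 ≤ hi) (hj1 : j + 1 ≤ hi) (hr : i - j + 2 ≤ M)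
    (hl : j - i + 2 ≤ M) (hb : b + 2 * M + 4 ≤ i + j) {η : V × V → unitInterval}
    (hη : (η (φ i j, φ i (j + 1)) : ℝ) ≤ 3 / 4) :
    ConeBlue φ M b (stepSet G Z η) i (j + 1) := by
  intro i' j' h1 h2 h3 h4 h5
  by_cases hne : i' < i ∨ j' < j + 1
  · exact h.row hφ hlo hi1 hj1 hr hb η h1 h2 hne h3 h4 h5
  · obtain rfl : i' = i := by omega
    obtain rfl : j' = j + 1 := by omega
    refine Or.inr ⟨φ i' j, h _ _ le_rfl le_rfl (by omega) (by omega) (by omega),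
      hφ.adj_up (by omega) (by omega) (by omega) (by omega), le_trans hη ?_⟩
    refine hφ.three_quarters_le_forceProb (by omega) (by omega) (by omega) (by omega) ?_ ?_ ?_ <;>
      exact h _ _ (by omega) (by omega) (by omega) (by omega) (by omega)

/-- The new cone avoids the uncertain tip `(i, j + 1)`, so this move is free. With
`ConeBlue.downRight` it makes the reset possible after a failed round. -/
lemma ConeBlue.upLeft (hφ : IsChart G φ lo hi) {i j : ℤ} (h : ConeBlue φ M b Z i j)
    (hlo : 2 * lo ≤ b - M) (hi1 : i + 1 ≤ hi) (hj1 : j + 1 ≤ hi) (hr : i - j + 2 ≤ M)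
    (hb : b + 2 * M + 4 ≤ i + j) (η : V × V → unitInterval) :
    ConeBlue φ M b (stepSet G Z η) (i - 1) (j + 1) :=
  fun _ _ h1 h2 h3 h4 h5 =>
    h.row hφ hlo hi1 hj1 hr hb η (by omega) h2 (Or.inl (by omega)) h3 h4 h5

lemma ConeBlue.right (hφ : IsChart G φ lo hi) {i j : ℤ} (h : ConeBlue φ M b Z i j)
    (hlo : 2 * lo ≤ b - M) (hi1 : i + 1 ≤ hi) (hj1 : j + 1 ≤ hi) (hr : i - j + 2 ≤ M)
    (hl : j - i + 2 ≤ M) (hb : b + 2 * M + 4 ≤ i + j) {η : V × V → unitInterval}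
    (hη : (η (φ i j, φ (i + 1) j) : ℝ) ≤ 3 / 4) :
    ConeBlue φ M b (stepSet G Z η) (i + 1) j :=
  (h.swap.up hφ.swap hlo hj1 hi1 hl hr (by omega) hη).swap

lemma ConeBlue.downRight (hφ : IsChart G φ lo hi) {i j : ℤ} (h : ConeBlue φ M b Z i j)
    (hlo : 2 * lo ≤ b - M) (hi1 : i + 1 ≤ hi) (hj1 : j + 1 ≤ hi)
    (hl : j - i + 2 ≤ M) (hb : b + 2 * M + 4 ≤ i + j) (η : V × V → unitInterval) :
    ConeBlue φ M b (stepSet G Z η) (i + 1) (j - 1) :=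
  (h.swap.upLeft hφ.swap hlo hj1 hi1 hl (by omega) η).swap

end Chart

/-! ### The law of the next diagonal. -/

section Diagonal

variable {V : Type*} {G : SimpleGraph V} {φ : ℤ → ℤ → V} {lo hi : ℤ} {d : ℕ}

/-- Whether the `b`-th parent of the vertex `u s` of the next diagonal is blue. -/
def parentBlue (C : Config d) (s : Fin (d + 1)) (b : Bool) : Bool :=
  if b then (Fin.cons false C : Config (d + 1)) s else (Fin.snoc C false : Config (d + 1)) s

/-- The attempt of the `b`-th parent of `u s` on `u s`, for the window at position `a` of the
level `k`. -/
def attempt (φ : ℤ → ℤ → V) (a k : ℤ) (s : Fin (d + 1)) (b : Bool) : V × V :=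
  (if b then φ (a + s - 1) (k + 1 - a - s) else φ (a + s) (k - a - s), φ (a + s) (k + 1 - a - s))

/-- The colours of the next diagonal if each attempt succeeds with probability `3 / 4` only. -/
def diagOf (φ : ℤ → ℤ → V) (C : Config d) (a k : ℤ) (η : V × V → unitInterval) : Config (d + 1) :=
  fun s => open Classical in decide
    (∃ b, parentBlue C s b = true ∧ (η (attempt φ a k s b) : ℝ) ≤ 3 / 4)

lemma measurable_diagOf (C : Config d) (a k : ℤ) : Measurable (diagOf φ C a k) := by
  refine measurable_pi_iff.2 fun s => measurable_to_bool ?_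
  have : (fun η : V × V → unitInterval => diagOf φ C a k η s) ⁻¹' {true} =
      ⋃ b, {η | parentBlue C s b = true ∧ (η (attempt φ a k s b) : ℝ) ≤ 3 / 4} := by
    ext η
    simp [diagOf]
  rw [this]
  refine MeasurableSet.iUnion fun b => MeasurableSet.const _ |>.inter ?_
  have hm : Measurable fun η : V × V → unitInterval => (η (attempt φ a k s b) : ℝ) :=
    measurable_subtype_coe.comp (measurable_pi_apply _)
  exact measurableSet_le hm measurable_const

/-- The measure of the event that no blue parent succeeds. -/
lemma infinitePi_bool_real (c : Bool → Bool) :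
    (Measure.infinitePi fun _ : Bool => (volume : Measure unitInterval)).real
      {x | ∀ b, c b = true → ¬ ((x b : ℝ) ≤ 3 / 4)} =
      (1 / 4) ^ ((c true).toNat + (c false).toNat) := by
  set q : unitInterval := ⟨3 / 4, by norm_num, by norm_num⟩
  have hset : {x : Bool → unitInterval | ∀ b, c b = true → ¬ ((x b : ℝ) ≤ 3 / 4)} =
      Set.pi ((Finset.univ : Finset Bool) : Set Bool)
        (fun b => if c b = true then Set.Ioi q else Set.univ) := by
    ext x
    simp only [Set.mem_ofPred_eq, Finset.coe_univ, Set.mem_pi, Set.mem_univ, true_imp_iff]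
    refine forall_congr' fun b => ?_
    by_cases h : c b = true
    · simp only [h, true_imp_iff, if_true, Set.mem_Ioi, not_le]
      rfl
    · simp [h]
  have hv : (volume (Set.Ioi q)).toReal = 1 / 4 := by
    rw [unitInterval.volume_Ioi]
    norm_num [q]
  rw [hset, measureReal_def, Measure.infinitePi_pi _ fun b _ => by split_ifs <;> measurability,
    Fintype.prod_bool, ENNReal.toReal_mul]
  rcases hc1 : c true <;> rcases hc2 : c false <;>
    simp [-unitInterval.volume_Ioi, hv]
  norm_num

/-- Distinct attempts read distinct uniform numbers, whence independence. Fictitious parents at both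
ends are included so that the index set is a product; they use the margin of the chart. -/
lemma IsChart.injective_attempt (hφ : IsChart G φ lo hi) {a k : ℤ} (h1 : lo ≤ a) (h2 : a + d ≤ hi)
    (h3 : lo ≤ k - a - d) (h4 : k + 1 - a ≤ hi) :
    Function.Injective fun e : Fin (d + 1) × Bool => attempt φ a k e.1 e.2 := by
  rintro ⟨s, b⟩ ⟨s', b'⟩ h
  simp only [attempt, Prod.mk.injEq] at h
  have hs := s.is_le
  have hs' := s'.is_le
  have hss := (hφ.eq_iff (by omega) (by omega) (by omega) (by omega) (by omega) (by omega)
    (by omega) (by omega)).1 h.2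
  obtain rfl : s = s' := by
    ext
    omega
  have hb : b = b' := by
    by_contra hb
    have h0 : φ (a + s - 1) (k + 1 - a - s) = φ (a + s) (k - a - s) := by
      cases b <;> cases b' <;> simp_all
    have := (hφ.eq_iff (by omega) (by omega) (by omega) (by omega) (by omega) (by omega)
      (by omega) (by omega)).1 h0
    omega
  rw [hb]

/-- Grouped by target, the attempts form independent pairs, so the law is a product; a target stays
white when none of its blue parents succeeds. -/
lemma IsChart.real_diagOf (hφ : IsChart G φ lo hi) {a k : ℤ} (h1 : lo ≤ a) (h2 : a + d ≤ hi)
    (h3 : lo ≤ k - a - d) (h4 : k + 1 - a ≤ hi) (C : Config d) (U : Config (d + 1)) :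
    (roundMeasure V).real (diagOf φ C a k ⁻¹' {U}) = diagProb C U := by
  set μb := Measure.infinitePi fun _ : Bool => (volume : Measure unitInterval)
  have hmap : (roundMeasure V).map (fun η (s : Fin (d + 1)) (b : Bool) => η (attempt φ a k s b)) =
      Measure.infinitePi fun _ : Fin (d + 1) => μb := by
    have e1 := Measure.map_infinitePi_infinitePi_of_inj
      (P := fun _ : V × V => (volume : Measure unitInterval)) (hφ.injective_attempt h1 h2 h3 h4)
    have e2 := Measure.infinitePi_map_curry
      (fun (_ : Fin (d + 1)) (_ : Bool) => (volume : Measure unitInterval))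
    rw [← e1, Measure.map_map (by fun_prop) (by fun_prop)] at e2
    exact e2
  set W : Fin (d + 1) → Set (Bool → unitInterval) := fun s =>
    {x | ∀ b, parentBlue C s b = true → ¬ ((x b : ℝ) ≤ 3 / 4)} with hW
  have hWm : ∀ s, MeasurableSet (W s) := by
    intro s
    have : W s = ⋂ b, {x | parentBlue C s b = true → ¬ ((x b : ℝ) ≤ 3 / 4)} := by
      ext x
      simp [hW]
    rw [this]
    refine MeasurableSet.iInter fun b => ?_
    by_cases hb : parentBlue C s b = true
    · have hm : Measurable fun x : Bool → unitInterval => (x b : ℝ) :=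
        measurable_subtype_coe.comp (measurable_pi_apply _)
      simp only [hb, true_imp_iff]
      exact (measurableSet_le hm measurable_const).compl
    · simp [hb]
  have hpre : diagOf φ C a k ⁻¹' {U} =
      (fun η (s : Fin (d + 1)) (b : Bool) => η (attempt φ a k s b)) ⁻¹'
        (Set.pi ((Finset.univ : Finset (Fin (d + 1))) : Set (Fin (d + 1)))
          fun s => if U s = true then (W s)ᶜ else W s) := by
    ext η
    simp only [Set.mem_preimage, Set.mem_singleton_iff, Finset.coe_univ, Set.mem_pi, Set.mem_univ,
      true_imp_iff, funext_iff]
    refine forall_congr' fun s => ?_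
    by_cases hU : U s = true
    · simp only [hU, diagOf, hW, decide_eq_true_iff, if_true, Set.mem_compl_iff,
        Set.mem_ofPred_eq, not_forall, not_not, exists_prop]
    · simp [hU, diagOf, hW]
  have hm : ∀ s, MeasurableSet (if U s = true then (W s)ᶜ else W s) := fun s => by
    split_ifs
    · exact (hWm s).compl
    · exact hWm s
  rw [hpre, measureReal_def, ← Measure.map_apply (by fun_prop)
    (MeasurableSet.pi (Finset.countable_toSet _) fun s _ => hm s), hmap,
    Measure.infinitePi_pi _ fun s _ => hm s, ENNReal.toReal_prod]
  refine Finset.prod_congr rfl fun s _ => ?_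
  have hWs : μb.real (W s) = (1 / 4) ^ blueNbrs C s := infinitePi_bool_real _
  unfold turnBlueProb
  split_ifs
  · rw [← measureReal_def, probReal_compl_eq_one_sub (hWm s), hWs]
  · rw [← measureReal_def, hWs]
    ring

lemma IsChart.integral_le (hφ : IsChart G φ lo hi) {a k : ℤ} (h1 : lo ≤ a) (h2 : a + d ≤ hi)
    (h3 : lo ≤ k - a - d) (h4 : k + 1 - a ≤ hi) (C : Config d) {F : (V × V → unitInterval) → ℝ}
    (hF : Integrable F (roundMeasure V)) {g : Config (d + 1) → ℝ}
    (hg : ∀ η, F η ≤ g (diagOf φ C a k η)) :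
    ∫ η, F η ∂(roundMeasure V) ≤ ∑ U, diagProb C U * g U := by
  have hm := measurable_diagOf (φ := φ) C a k
  have : IsProbabilityMeasure ((roundMeasure V).map (diagOf φ C a k)) :=
    Measure.isProbabilityMeasure_map hm.aemeasurable
  have hgm : StronglyMeasurable g := (measurable_of_finite g).stronglyMeasurable
  have hgi : Integrable g ((roundMeasure V).map (diagOf φ C a k)) := Integrable.of_finite
  calc ∫ η, F η ∂(roundMeasure V) ≤ ∫ η, g (diagOf φ C a k η) ∂(roundMeasure V) :=
        integral_mono hF (hgi.comp_measurable hm) hg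
    _ = ∫ U, g U ∂((roundMeasure V).map (diagOf φ C a k)) :=
        (integral_map hm.aemeasurable hgm.aestronglyMeasurable).symm
    _ = ∑ U, diagProb C U * g U := by
        rw [integral_fintype hgi]
        refine Finset.sum_congr rfl fun U _ => ?_
        rw [map_measureReal_apply hm (MeasurableSet.singleton U),
          hφ.real_diagOf h1 h2 h3 h4, smul_eq_mul]

end Diagonal

/-! ### One round of the process as a step of the chain. -/

section Window

variable {V : Type*} {G : SimpleGraph V} {φ : ℤ → ℤ → V} {lo hi M b : ℤ} {d : ℕ} {Z : Set V}

lemma someBlue_spec {C : Config d} (hC : C ≠ allWhite d) :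
    ∃ r : Fin d, C r = true ∧ someBlue C = (r : ℕ) := by
  have h := ne_allWhite_iff.1 hC
  exact ⟨h.choose, h.choose_spec, by rw [someBlue, dif_pos h]⟩

lemma pickBlue_spec {C : Config d} (hC : C ≠ allWhite d) (c : Bool) :
    ∃ r : Fin d, C r = true ∧ pickBlue C c = (r : ℕ) := by
  cases c
  · obtain ⟨r, h1, h2⟩ := someBlue_spec (C := C ∘ Fin.rev) (by rwa [Ne, comp_rev_eq_allWhite])
    refine ⟨Fin.rev r, h1, ?_⟩
    have := r.2
    simp only [pickBlue, h2, Fin.val_rev, Bool.false_eq_true, if_false]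
    omega
  · obtain ⟨r, h1, h2⟩ := someBlue_spec hC
    exact ⟨r, h1, by simp [pickBlue, h2]⟩

/-- The blue vertices of the configuration `C`, placed on the window at position `a` of the level
`k`, have blue cones. -/
def WindowBlue (φ : ℤ → ℤ → V) (M b : ℤ) (Z : Set V) (C : Config d) (a k : ℤ) : Prop :=
  ∀ s : Fin d, C s = true → ConeBlue φ M b Z (a + s) (k - a - s)

/-- The blue set `Z` realizes the state `C` of the chain at the level `k`, the centre of the window
having transversal coordinate `y`. In the all white state there are three consecutive vertices with
blue cones on the previous level. -/
def Realizes (φ : ℤ → ℤ → V) (M b : ℤ) (Z : Set V) (C : Config d) (y k : ℤ) : Prop :=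
  if C = allWhite d then ∃ m, y = 2 * m - (k - 1) ∧
    ∀ e, -1 ≤ e → e ≤ 1 → ConeBlue φ M b Z (m + e) (k - 1 - m - e)
  else ∃ a, y = 2 * a - k + d - 1 ∧ WindowBlue φ M b Z C a k

/-- A mere relabelling of `Z`, without a round: the three cones one level below become the window.
For `d = 2` the bit selects which two of the three are used. -/
lemma Realizes.reset (hd : 2 ≤ d) {y k : ℤ} (h : Realizes φ M b Z (allWhite d) y k)
    (x : Config (d + 1) × Bool) :
    Realizes φ M b Z (nextConfig (allWhite d) x) (y + shift (allWhite d) x)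
      (k + levelStep (allWhite d)) := by
  obtain ⟨U, c⟩ := x
  rw [Realizes, if_pos rfl] at h
  obtain ⟨m, rfl, hm⟩ := h
  have hcone : ∀ i j, i + j = k - 1 → m - 1 ≤ i → i ≤ m + 1 → ConeBlue φ M b Z i j := by
    intro i j h1 h2 h3
    have := hm (i - m) (by omega) (by omega)
    rwa [add_sub_cancel, show k - 1 - m - (i - m) = j by omega] at this
  have hne : nextConfig (allWhite d) (U, c) ≠ allWhite d := by
    rw [nextConfig, if_pos rfl]
    exact resetConfig_ne_allWhite hd c
  rw [Realizes, if_neg hne]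
  simp only [nextConfig, shift, levelStep, if_true]
  by_cases h2 : d = 2
  · subst h2
    rw [if_neg (show ¬ Odd 2 by decide), resetConfig, if_pos rfl]
    cases c
    · exact ⟨m - 1, by simp; ring, fun s _ => hcone _ _ (by ring) (by omega) (by omega)⟩
    · exact ⟨m, by simp; ring, fun s _ => hcone _ _ (by ring) (by omega) (by omega)⟩
  · rw [resetConfig, if_neg h2]
    by_cases h3 : Odd d
    · rw [if_pos h3, if_pos h3]
      obtain ⟨r, hr⟩ := h3
      refine ⟨m - 1 - ((d - 3) / 2 : ℕ), by omega, fun s hs => ?_⟩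
      have hs' := of_decide_eq_true hs
      exact hcone _ _ (by ring) (by omega) (by omega)
    · rw [if_neg h3, if_neg h3]
      obtain ⟨r, hr⟩ := Nat.not_odd_iff_even.1 h3
      cases c
      · refine ⟨m - 1 - ((d - 2) / 2 : ℕ), by simp; omega, fun s hs => ?_⟩
        have hs' := of_decide_eq_true hs
        exact hcone _ _ (by ring) (by omega) (by omega)
      · refine ⟨m - 1 - ((d - 4) / 2 : ℕ), by simp; omega, fun s hs => ?_⟩
        have hs' := of_decide_eq_true hs
        exact hcone _ _ (by ring) (by omega) (by omega)

/-- A vertex of the band at level at least `2l + M` dominates `(l, l)`, so its cone contains the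
target. -/
lemma Realizes.target_mem {C : Config d} (hC : C ≠ allWhite d) {y k l : ℤ}
    (h : Realizes φ M b Z C y k) (hk : 2 * l + M ≤ k) (hy1 : y + d + 4 ≤ M)
    (hy2 : -y + d + 4 ≤ M) (hb : b ≤ 2 * l) : φ l l ∈ Z := by
  rw [Realizes, if_neg hC] at h
  obtain ⟨a, rfl, ha⟩ := h
  obtain ⟨s, hs⟩ := ne_allWhite_iff.1 hC
  have := s.2
  exact ha s hs l l (by omega) (by omega) (by omega) (by omega) (by omega)

variable [Finite V]

/-- A window with blue cones, one round later. -/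
lemma WindowBlue.step (hφ : IsChart G φ lo hi) {C : Config d} {a k : ℤ}
    (h : WindowBlue φ M b Z C a k) (hlo : 2 * lo ≤ b - M) (hhi : k + M + 2 ≤ 2 * hi)
    (hb : b + 2 * M + 4 ≤ k) (hy1 : 2 * a - k + d - 1 + d + 4 ≤ M)
    (hy2 : -(2 * a - k + d - 1) + d + 4 ≤ M) (η : V × V → unitInterval) :
    (∀ s, diagOf φ C a k η s = true →
      ConeBlue φ M b (stepSet G Z η) (a + s) (k + 1 - a - s)) ∧
    ∀ s : Fin d, C s = true → ∀ e, -1 ≤ e → e ≤ 1 →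
      ConeBlue φ M b (stepSet G Z η) (a + s + e) (k - a - s - e) := by
  constructor
  · intro s hs
    obtain ⟨c, hc, hη⟩ := of_decide_eq_true hs
    cases c
    · rcases Fin.eq_castSucc_or_eq_last s with ⟨r, rfl⟩ | rfl
      · simp only [parentBlue, Bool.false_eq_true, if_false, Fin.snoc_castSucc] at hc
        have hr := r.2
        simp only [attempt, Bool.false_eq_true, if_false, Fin.val_castSucc] at hη
        have := (h r hc).up hφ hlo (by omega) (by omega) (by omega) (by omega) (by omega) (η := η)
          (by rwa [show k - a - (r : ℤ) + 1 = k + 1 - a - r by ring])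
        rwa [show k - a - (r : ℤ) + 1 = k + 1 - a - r by ring] at this
      · simp [parentBlue] at hc
    · rcases Fin.eq_zero_or_eq_succ s with rfl | ⟨r, rfl⟩
      · simp [parentBlue] at hc
      · simp only [parentBlue, if_true, Fin.cons_succ] at hc
        have hr := r.2
        simp only [attempt, if_true, Fin.val_succ, Nat.cast_add, Nat.cast_one] at hη ⊢
        have e1 : a + ((r : ℤ) + 1) - 1 = a + r := by ring
        have e2 : a + ((r : ℤ) + 1) = a + r + 1 := by ring
        have e3 : k + 1 - a - ((r : ℤ) + 1) = k - a - r := by ring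
        rw [e1, e2, e3] at hη
        rw [e2, e3]
        exact (h r hc).right hφ hlo (by omega) (by omega) (by omega) (by omega) (by omega) hη
  · intro s hs e h1 h2
    have hr := s.2
    obtain rfl | rfl | rfl : e = -1 ∨ e = 0 ∨ e = 1 := by omega
    · rw [sub_neg_eq_add]
      exact (h s hs).upLeft hφ hlo (by omega) (by omega) (by omega) (by omega) η
    · rw [add_zero, sub_zero]
      exact (h s hs).mono (subset_stepSet _ _)
    · exact (h s hs).downRight hφ hlo (by omega) (by omega) (by omega) (by omega) η

/-- If the next diagonal is white, the sideways spread around one old blue vertex supplies the three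
cones; otherwise the selected half of the diagonal is the new window. -/
lemma WindowBlue.realizes_next (hd : 2 ≤ d) (hφ : IsChart G φ lo hi) {C : Config d}
    (hC : C ≠ allWhite d) {a k : ℤ}
    (h : WindowBlue φ M b Z C a k) (hlo : 2 * lo ≤ b - M) (hhi : k + M + 2 ≤ 2 * hi)
    (hb : b + 2 * M + 4 ≤ k) (hy1 : 2 * a - k + d - 1 + d + 4 ≤ M)
    (hy2 : -(2 * a - k + d - 1) + d + 4 ≤ M) (η : V × V → unitInterval) (c : Bool) :
    Realizes φ M b (stepSet G Z η) (nextConfig C (diagOf φ C a k η, c))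
      (2 * a - k + d - 1 + shift C (diagOf φ C a k η, c)) (k + levelStep C) := by
  obtain ⟨h1, h2⟩ := h.step hφ hlo hhi hb hy1 hy2 η
  set U := diagOf φ C a k η
  rw [levelStep, if_neg hC, shift, if_neg hC]
  by_cases hU : U = allWhite (d + 1)
  · rw [hU, nextConfig_allWhite hC, Realizes, if_pos rfl, if_pos rfl]
    obtain ⟨r, hr, hp⟩ := pickBlue_spec hC c
    refine ⟨a + r, by simp only [hp]; ring, fun e he1 he2 => ?_⟩
    have := h2 r hr e he1 he2
    rwa [show k - a - (r : ℤ) - e = k + 1 - 1 - (a + r) - e by ring] at this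
  · rw [Realizes, if_neg (nextConfig_ne_allWhite hd hC hU c), if_neg hU, nextConfig, if_neg hC]
    simp only
    split_ifs
    · exact ⟨a, by ring, fun s hs => h1 s.castSucc hs⟩
    · refine ⟨a + 1, by ring, fun s hs => ?_⟩
      have := h1 s.succ hs
      rw [Fin.val_succ] at this
      push_cast at this
      rwa [show a + ((s : ℤ) + 1) = a + 1 + s by ring,
        show k + 1 - a - ((s : ℤ) + 1) = k + 1 - (a + 1) - s by ring] at this

end Window

/-! ### The quadratic Lyapunov function. -/

section Lyapunov

variable {d : ℕ}

/-- The second moment is the squared mean plus the variance. -/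
lemma sum_mul_sq_le {ι : Type*} (s : Finset ι) {w z : ι → ℝ} {m c : ℝ} (hw : ∀ i ∈ s, 0 ≤ w i)
    (h1 : ∑ i ∈ s, w i = 1) (hm : ∑ i ∈ s, w i * z i = m) (hc : ∀ i ∈ s, |z i - m| ≤ c) :
    ∑ i ∈ s, w i * z i ^ 2 ≤ m ^ 2 + c ^ 2 := by
  have h2 : ∑ i ∈ s, w i * z i ^ 2 = m ^ 2 + ∑ i ∈ s, w i * (z i - m) ^ 2 := by
    have : ∀ i, w i * (z i - m) ^ 2 = w i * z i ^ 2 - 2 * m * (w i * z i) + m ^ 2 * w i :=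
      fun i => by ring
    simp_rw [this, Finset.sum_add_distrib, Finset.sum_sub_distrib, ← Finset.mul_sum, hm, h1]
    ring
  rw [h2]
  have h3 : ∑ i ∈ s, w i * (z i - m) ^ 2 ≤ ∑ i ∈ s, w i * c ^ 2 := by
    refine Finset.sum_le_sum fun i hi => mul_le_mul_of_nonneg_left ?_ (hw i hi)
    exact sq_le_sq' (abs_le.1 (hc i hi)).1 (abs_le.1 (hc i hi)).2
  rw [← Finset.sum_mul, h1, one_mul] at h3
  linarith

/-- Correctors that turn level and transversal coordinate into martingales, with bounds. -/
structure Correctors (d : ℕ) (γ : ℝ) where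
  /-- the corrector of the level -/
  lev : Config d → ℝ
  /-- the corrector of the transversal coordinate -/
  trans : Config d → ℝ
  /-- a bound -/
  bd : ℝ
  sum_lev : ∀ C, ∑ x, noiseProb C x * (levelStep C - γ * timeStep C + lev (nextConfig C x)) = lev C
  sum_trans : ∀ C, ∑ x, noiseProb C x * (shift C x + trans (nextConfig C x)) = trans C
  abs_lev : ∀ C, |lev C| ≤ bd
  abs_trans : ∀ C, |trans C| ≤ bd
  abs_lev_step : ∀ C x, |levelStep C - γ * timeStep C + lev (nextConfig C x) - lev C| ≤ bd
  abs_trans_step : ∀ C x, |shift C x + trans (nextConfig C x) - trans C| ≤ bd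

lemma exists_correctors (hd : 2 ≤ d) {π : Config d → ℝ} (hs : IsStationary (windowChain d) π)
    (hl : IsLimiting (windowChain d) π) :
    Nonempty (Correctors d ((1 - 2 * π (allWhite d)) / (1 - π (allWhite d)))) := by
  obtain ⟨f, hf⟩ := exists_level_corrector hd hs hl rfl
  obtain ⟨g, hg⟩ := exists_shift_corrector hd hs hl
  have hb : ∀ {ι : Type} [Finite ι] (u : ι → ℝ), ∃ c, ∀ i, |u i| ≤ c := fun u => by
    obtain ⟨c, hc⟩ := Set.Finite.bddAbove (Set.finite_range fun i => |u i|)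
    exact ⟨c, fun i => hc ⟨i, rfl⟩⟩
  obtain ⟨c1, h1⟩ := hb f
  obtain ⟨c2, h2⟩ := hb g
  obtain ⟨c3, h3⟩ := hb fun p : Config d × Config (d + 1) × Bool => levelStep p.1 -
    (1 - 2 * π (allWhite d)) / (1 - π (allWhite d)) * timeStep p.1 + f (nextConfig p.1 p.2) - f p.1
  obtain ⟨c4, h4⟩ := hb fun p : Config d × Config (d + 1) × Bool =>
    shift p.1 p.2 + g (nextConfig p.1 p.2) - g p.1
  exact ⟨⟨f, g, max (max c1 c2) (max c3 c4), hf, hg,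
    fun C => (h1 C).trans (by simp), fun C => (h2 C).trans (by simp),
    fun C x => (h3 (C, x)).trans (by simp), fun C x => (h4 (C, x)).trans (by simp)⟩⟩

variable {γ : ℝ}

/-- The Lyapunov function, for a run with `T` remaining rounds. -/
def lyapunov (c : Correctors d γ) (K : ℝ) (C : Config d) (y k : ℤ) (T : ℕ) : ℝ :=
  (k + γ * T + c.lev C - K) ^ 2 + (y + c.trans C) ^ 2 + 4 * c.bd ^ 2 * T +
    if C = allWhite d then 2 * c.bd ^ 2 else 0

lemma lyapunov_nonneg (c : Correctors d γ) (K : ℝ) (C : Config d) (y k : ℤ) (T : ℕ) :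
    0 ≤ lyapunov c K C y k T := by
  unfold lyapunov
  split_ifs <;> positivity

lemma abs_lt_of_lyapunov_lt {c : Correctors d γ} {K : ℝ} {C : Config d} {y k : ℤ} {T : ℕ} {L : ℝ}
    (hL : 0 ≤ L) (h : lyapunov c K C y k T < L ^ 2) :
    |k + γ * T + c.lev C - K| < L ∧ |y + c.trans C| < L := by
  have h1 := sq_nonneg (k + γ * T + c.lev C - K)
  have h2 := sq_nonneg (y + c.trans C)
  have h3 : 0 ≤ 4 * c.bd ^ 2 * T := by positivity
  have h4 : 0 ≤ if C = allWhite d then 2 * c.bd ^ 2 else 0 := by split_ifs <;> positivity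
  unfold lyapunov at h
  constructor <;> refine abs_lt_of_sq_lt_sq ?_ hL <;> linarith

/-- Each chain step adds variance at most `2 * c.bd ^ 2` over the two martingales. A round releases
`4 * c.bd ^ 2`: half pays for the step, half is kept in the all white state for the reset, which has
no round of its own. -/
lemma sum_lyapunov_le (hd : 2 ≤ d) (c : Correctors d γ) (K : ℝ) (C : Config d) (y k : ℤ) (T : ℕ) :
    ∑ x, noiseProb C x * lyapunov c K (nextConfig C x) (y + shift C x) (k + levelStep C) T ≤
      lyapunov c K C y k (T + timeStep C) := by
  set A : ℝ := k + γ * (T + timeStep C : ℕ) + c.lev C - K with hA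
  set D : ℝ := y + c.trans C with hD
  set zA : Config (d + 1) × Bool → ℝ := fun x =>
    (k + levelStep C : ℤ) + γ * T + c.lev (nextConfig C x) - K with hzA
  set zD : Config (d + 1) × Bool → ℝ := fun x =>
    (y + shift C x : ℤ) + c.trans (nextConfig C x) with hzD
  have hw : ∀ x ∈ Finset.univ, 0 ≤ noiseProb C x := fun x _ => noiseProb_nonneg C x
  have h1 : ∑ x, noiseProb C x * zA x ^ 2 ≤ A ^ 2 + c.bd ^ 2 := by
    refine sum_mul_sq_le _ hw (sum_noiseProb C) ?_ fun x _ => ?_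
    · have : ∀ x, zA x = (levelStep C - γ * timeStep C + c.lev (nextConfig C x)) + (A - c.lev C) :=
        fun x => by
          simp only [hzA, hA]
          push_cast
          ring
      simp_rw [this, mul_add (noiseProb C _) (_ + _) (A - _), Finset.sum_add_distrib, c.sum_lev,
        ← Finset.sum_mul, sum_noiseProb]
      ring
    · refine le_trans (le_of_eq ?_) (c.abs_lev_step C x)
      congr 1
      simp only [hzA, hA]
      push_cast
      ring
  have h2 : ∑ x, noiseProb C x * zD x ^ 2 ≤ D ^ 2 + c.bd ^ 2 := by
    refine sum_mul_sq_le _ hw (sum_noiseProb C) ?_ fun x _ => ?_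
    · have : ∀ x, zD x = (shift C x + c.trans (nextConfig C x)) + (D - c.trans C) :=
        fun x => by
          simp only [hzD, hD]
          push_cast
          ring
      simp_rw [this, mul_add (noiseProb C _) (_ + _) (D - _), Finset.sum_add_distrib, c.sum_trans,
        ← Finset.sum_mul, sum_noiseProb]
      ring
    · refine le_trans (le_of_eq ?_) (c.abs_trans_step C x)
      congr 1
      simp only [hzD, hD]
      push_cast
      ring
  have h3 : ∑ x, noiseProb C x * (if nextConfig C x = allWhite d then 2 * c.bd ^ 2 else 0) ≤
      if C = allWhite d then 0 else 2 * c.bd ^ 2 := by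
    split_ifs with hC
    · refine le_of_eq (Finset.sum_eq_zero fun x _ => ?_)
      rw [nextConfig, if_pos hC, if_neg (resetConfig_ne_allWhite hd _), mul_zero]
    · calc _ ≤ ∑ x, noiseProb C x * (2 * c.bd ^ 2) := by
            refine Finset.sum_le_sum fun x _ => mul_le_mul_of_nonneg_left ?_ (noiseProb_nonneg C x)
            split_ifs
            · exact le_rfl
            · positivity
        _ = _ := by rw [← Finset.sum_mul, sum_noiseProb, one_mul]
  have h4 : ∑ x, noiseProb C x * (4 * c.bd ^ 2 * T) = 4 * c.bd ^ 2 * T := by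
    rw [← Finset.sum_mul, sum_noiseProb, one_mul]
  calc _ = ∑ x, noiseProb C x * zA x ^ 2 + ∑ x, noiseProb C x * zD x ^ 2 +
        ∑ x, noiseProb C x * (4 * c.bd ^ 2 * T) +
        ∑ x, noiseProb C x * (if nextConfig C x = allWhite d then 2 * c.bd ^ 2 else 0) := by
        simp_rw [← Finset.sum_add_distrib, ← mul_add]
        rfl
    _ ≤ A ^ 2 + c.bd ^ 2 + (D ^ 2 + c.bd ^ 2) + 4 * c.bd ^ 2 * T +
        if C = allWhite d then 0 else 2 * c.bd ^ 2 := by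
        rw [h4]
        linarith
    _ = _ := by
        unfold lyapunov
        rw [← hA, ← hD]
        by_cases hC : C = allWhite d
        · simp only [hC, if_true, timeStep, add_zero]
          ring
        · simp only [hC, if_false, timeStep]
          push_cast
          ring

variable {V : Type*} [Finite V] {G : SimpleGraph V} {φ : ℤ → ℤ → V} {lo hi M b : ℤ}

/-- If `Z` realizes a state of the chain, then the probability that the vertex `(l, l)` is still
white after `T` rounds is bounded by the Lyapunov function. -/
lemma fail_mul_le_lyapunov (hd : 2 ≤ d) (c : Correctors d γ) (hγ : 0 ≤ γ) (hφ : IsChart G φ lo hi)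
    {l : ℤ} {L : ℝ} (hL : 0 ≤ L) (hM : L + c.bd + d + 4 ≤ M) {T₀ : ℕ} (hlo : 2 * lo ≤ b - M)
    (hhi : 2 * l + 2 * M + 2 ≤ 2 * hi) (hb : (b : ℝ) + 2 * M + 4 + γ * T₀ ≤ 2 * l + M)
    (hbl : b ≤ 2 * l) (T : ℕ)
    (hT : T ≤ T₀) (C : Config d) (hC : C ≠ allWhite d) (y k : ℤ) (Z : Set V)
    (hZ : Realizes φ M b Z C y k) :
    fail G Z {φ l l} T * L ^ 2 ≤ lyapunov c (2 * l + M + L + c.bd) C y k T := by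
  set K : ℝ := 2 * l + M + L + c.bd with hK
  induction T generalizing C y k Z with
  | zero =>
    -- Where the Lyapunov function is at least `L ^ 2` the bound is trivial, since `fail ≤ 1`.
    -- Otherwise level and transversal coordinate are under control; this plays the role of a
    -- stopping time.
    by_contra! hlt
    obtain ⟨hA, hD⟩ := abs_lt_of_lyapunov_lt hL (hlt.trans_le
      (mul_le_of_le_one_left (by positivity) (fail_le_one _ _ _)))
    have hlev := abs_le.1 (c.abs_lev C)
    have htr := abs_le.1 (c.abs_trans C)
    rw [abs_lt] at hA hD
    push_cast at hA
    have hk : 2 * l + M ≤ k := by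
      have : (2 * l + M : ℝ) ≤ k := by linarith
      exact_mod_cast this
    have hy1 : y + d + 4 ≤ M := by
      have : (y + d + 4 : ℝ) ≤ M := by linarith
      exact_mod_cast this
    have hy2 : -y + d + 4 ≤ M := by
      have : (-y + d + 4 : ℝ) ≤ M := by linarith
      exact_mod_cast this
    rw [fail_eq_zero (by simpa using hZ.target_mem hC hk hy1 hy2 hbl), zero_mul] at hlt
    exact absurd hlt (lyapunov_nonneg _ _ _ _ _ _).not_gt
  | succ T ih =>
    by_contra! hlt
    obtain ⟨hA, hD⟩ := abs_lt_of_lyapunov_lt hL (hlt.trans_le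
      (mul_le_of_le_one_left (by positivity) (fail_le_one _ _ _)))
    have hlev := abs_le.1 (c.abs_lev C)
    have htr := abs_le.1 (c.abs_trans C)
    rw [abs_lt] at hA hD
    have hy1 : y + d + 4 ≤ M := by
      have : (y + d + 4 : ℝ) ≤ M := by linarith
      exact_mod_cast this
    have hy2 : -y + d + 4 ≤ M := by
      have : (-y + d + 4 : ℝ) ≤ M := by linarith
      exact_mod_cast this
    have hk : k < 2 * l + M := by
      by_contra! hk
      rw [fail_eq_zero (by simpa using hZ.target_mem hC hk hy1 hy2 hbl), zero_mul] at hlt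
      exact absurd hlt (lyapunov_nonneg _ _ _ _ _ _).not_gt
    -- The level lags behind `K - γ (T + 1)` by less than `L + c.bd`, and `hb` makes that enough to
    -- stay clear of the base of the cones.
    have hkb : b + 2 * M + 4 ≤ k := by
      have h1 : γ * (T + 1 : ℕ) ≤ γ * T₀ :=
        mul_le_mul_of_nonneg_left (by exact_mod_cast hT) hγ
      have : (b + 2 * M + 4 : ℝ) ≤ k := by linarith
      exact_mod_cast this
    rw [Realizes, if_neg hC] at hZ
    obtain ⟨a, rfl, ha⟩ := hZ
    have hall : ∀ (C' : Config d) (y' k' : ℤ) (Z' : Set V), Realizes φ M b Z' C' y' k' →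
        fail G Z' {φ l l} T * L ^ 2 ≤ lyapunov c K C' y' k' T := by
      intro C' y' k' Z' hZ'
      -- The reset takes no round, so the induction hypothesis with the same `T` applies after it,
      -- averaged over the noise.
      by_cases hC' : C' = allWhite d
      · subst hC'
        calc fail G Z' {φ l l} T * L ^ 2
            = ∑ x, noiseProb (allWhite d) x * (fail G Z' {φ l l} T * L ^ 2) := by
              rw [← Finset.sum_mul, sum_noiseProb, one_mul]
          _ ≤ _ := Finset.sum_le_sum fun x _ => mul_le_mul_of_nonneg_left
              (ih (by omega) _ (by rw [nextConfig, if_pos rfl]; exact resetConfig_ne_allWhite hd _)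
                _ _ _ (hZ'.reset hd x)) (noiseProb_nonneg _ x)
          _ ≤ _ := sum_lyapunov_le hd c K (allWhite d) y' k' T
          _ = _ := by simp [timeStep]
      · exact ih (by omega) C' hC' y' k' Z' hZ'
    have hstep : ∀ η e, fail G (stepSet G Z η) {φ l l} T * L ^ 2 ≤
        lyapunov c K (nextConfig C (diagOf φ C a k η, e))
          (2 * a - k + d - 1 + shift C (diagOf φ C a k η, e)) (k + levelStep C) T := fun η e =>
      hall _ _ _ _ (ha.realizes_next hd hφ hC hlo (by omega) hkb hy1 hy2 η e)
    have hint := (integrable_fail (G := G) Z {φ l l} T (roundMeasure V)).mul_const (L ^ 2)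
    -- The bit is not part of the run; the bound holds for both its values, hence for their average.
    have hle := hφ.integral_le (a := a) (k := k) (by omega) (by omega) (by omega) (by omega) C hint
      (g := fun U => (lyapunov c K (nextConfig C (U, true))
          (2 * a - k + d - 1 + shift C (U, true)) (k + levelStep C) T +
        lyapunov c K (nextConfig C (U, false))
          (2 * a - k + d - 1 + shift C (U, false)) (k + levelStep C) T) / 2)
      (fun η => by linarith [hstep η true, hstep η false])
    rw [integral_mul_const, ← fail_succ, ← sum_noiseProb_mul C fun x =>
      lyapunov c K (nextConfig C x) (2 * a - k + d - 1 + shift C x) (k + levelStep C) T] at hle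
    have hsum := sum_lyapunov_le hd c K C (2 * a - k + d - 1) k T
    rw [timeStep, if_neg hC] at hsum
    linarith

end Lyapunov

/-! ### A run along one diagonal. -/

section DiagonalRun

variable {V : Type*} [Finite V] {G : SimpleGraph V} {φ : ℤ → ℤ → V} {d : ℕ} {γ : ℝ}

/-- A square of side `O(M)` is first made blue by the crude bound, and the chain then starts all
blue at level 0. `T₀` is chosen to centre the level term, so the Lyapunov function starts at `O(1 +
T₀)`; division by `(M / 2) ^ 2` is Chebyshev's inequality. -/
lemma fail_diagonal_le (hd : 2 ≤ d) (c : Correctors d γ) (hγ : 0 ≤ γ)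
    (hdeg : ∀ u, (G.neighborSet u).ncard ≤ 4) (hG : G.Connected) {M l : ℕ}
    (hM : 2 * (c.bd + d + 4) ≤ M) (hφ : IsChart G φ (-(2 * M + 6)) (l + M + 1))
    (hdist : ∀ i j : ℤ, |i| ≤ 2 * M + 3 → |j| ≤ 2 * M + 3 → G.dist (φ 0 0) (φ i j) ≤ 4 * M + 6)
    {T₀ : ℕ} (hT1 : 2 * l + M + M / 2 + c.bd ≤ γ * T₀)
    (hT2 : γ * T₀ ≤ 2 * l + M + M / 2 + c.bd + 1) :
    fail G {φ 0 0} {φ l l} (20 * (4 * M + 6) + T₀) ≤ Nat.card V * (1 / 10) ^ (4 * M + 6) +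
      (2 * (d + 1 + c.bd) ^ 2 + 4 * c.bd ^ 2 * T₀) * 4 / M ^ 2 := by
  have hbd : 0 ≤ c.bd := (abs_nonneg _).trans (c.abs_lev (allBlue d))
  have hM0 : (0 : ℝ) < M := by
    have : (0 : ℝ) ≤ d := Nat.cast_nonneg d
    linarith
  have hdM : (d : ℝ) ≤ M := by linarith
  have hdM' : d ≤ M := by exact_mod_cast hdM
  set S : Set V := {v | ∃ i j : ℤ, |i| ≤ 2 * M + 3 ∧ |j| ≤ 2 * M + 3 ∧ v = φ i j} with hS
  have h1 : fail G {φ 0 0} S (20 * (4 * M + 6)) ≤ Nat.card V * (1 / 10) ^ (4 * M + 6) := by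
    refine fail_le_of_dist hdeg hG ?_
    rintro w ⟨i, j, hi, hj, rfl⟩
    exact ⟨_, rfl, hdist i j hi hj⟩
  have hne : allBlue d ≠ allWhite d := ne_allWhite_iff.2 ⟨⟨0, by omega⟩, rfl⟩
  -- The initial cones, cut off by the band and by the level `-(3M + 5)`, fit into the square `S`.
  have hreal : Realizes φ M (-(3 * M + 5)) S (allBlue d) (d - 1) 0 := by
    rw [Realizes, if_neg hne]
    refine ⟨0, by ring, fun s _ i j h1 h2 h3 h4 h5 => ?_⟩
    have := s.2
    exact ⟨i, j, abs_le.2 ⟨by omega, by omega⟩, abs_le.2 ⟨by omega, by omega⟩, rfl⟩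
  have h2 := fail_mul_le_lyapunov hd c hγ hφ (l := l) (L := M / 2) (M := M) (b := -(3 * M + 5))
    (T₀ := T₀) (by positivity) (by push_cast; linarith) (by omega) (by omega)
    (by push_cast; linarith) (by omega) T₀ le_rfl (allBlue d) hne (d - 1) 0 S hreal
  have h3 : lyapunov c (2 * (l : ℤ) + (M : ℤ) + M / 2 + c.bd) (allBlue d) (d - 1) 0 T₀ ≤
      2 * (d + 1 + c.bd) ^ 2 + 4 * c.bd ^ 2 * T₀ := by
    unfold lyapunov
    rw [if_neg hne]
    have hlev := abs_le.1 (c.abs_lev (allBlue d))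
    have htr := abs_le.1 (c.abs_trans (allBlue d))
    have hd0 : (0 : ℝ) ≤ d := Nat.cast_nonneg d
    push_cast
    have e1 : (0 + γ * T₀ + c.lev (allBlue d) - (2 * l + M + M / 2 + c.bd)) ^ 2 ≤
        (d + 1 + c.bd) ^ 2 := sq_le_sq' (by linarith) (by linarith)
    have hd2 : (2 : ℝ) ≤ d := by exact_mod_cast hd
    have e2 : ((d : ℝ) - 1 + c.trans (allBlue d)) ^ 2 ≤ (d + 1 + c.bd) ^ 2 :=
      sq_le_sq' (by linarith) (by linarith)
    linarith
  have h4 : fail G S {φ l l} T₀ ≤ (2 * (d + 1 + c.bd) ^ 2 + 4 * c.bd ^ 2 * T₀) * 4 / M ^ 2 := by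
    rw [le_div_iff₀ (by positivity)]
    have h5 := h2.trans h3
    have h6 : ((M : ℝ) / 2) ^ 2 = M ^ 2 / 4 := by ring
    rw [h6] at h5
    linarith
  exact (fail_add _ S _ _ _).trans (add_le_add h1 h4)

end DiagonalRun

/-! ### Coordinates, charts and distances in the grid. -/

section Grid

variable {n : ℕ} [NeZero n]

/-- The vertex of the grid with integer coordinates `x`, `y` in `[0, n)`. -/
def vtx (n : ℕ) [NeZero n] (x y : ℤ) : Fin n × Fin n := (Fin.ofNat n x.toNat, Fin.ofNat n y.toNat)

lemma val_ofNat_toNat {x : ℤ} (h0 : 0 ≤ x) (h1 : x < n) :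
    ((Fin.ofNat n x.toNat : Fin n) : ℤ) = x := by
  simp only [Fin.ofNat]
  rw [Nat.mod_eq_of_lt (by omega)]
  omega

lemma vtx_eq_iff {x y x' y' : ℤ} (h1 : 0 ≤ x) (h2 : x < n) (h3 : 0 ≤ y) (h4 : y < n)
    (h1' : 0 ≤ x') (h2' : x' < n) (h3' : 0 ≤ y') (h4' : y' < n) :
    vtx n x y = vtx n x' y' ↔ x = x' ∧ y = y' := by
  constructor
  · intro h
    have e1 := congrArg (fun u => ((u.1 : ℕ) : ℤ)) h
    have e2 := congrArg (fun u => ((u.2 : ℕ) : ℤ)) h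
    simp only [vtx] at e1 e2
    rw [val_ofNat_toNat h1 h2, val_ofNat_toNat h1' h2'] at e1
    rw [val_ofNat_toNat h3 h4, val_ofNat_toNat h3' h4'] at e2
    exact ⟨e1, e2⟩
  · rintro ⟨rfl, rfl⟩
    rfl

lemma vtx_val (u : Fin n × Fin n) : vtx n (u.1 : ℕ) (u.2 : ℕ) = u := by
  refine Prod.ext ?_ ?_ <;> ext <;> simp [vtx]

lemma grid_adj_vtx {x y x' y' : ℤ} (h1 : 0 ≤ x) (h2 : x < n) (h3 : 0 ≤ y) (h4 : y < n)
    (h1' : 0 ≤ x') (h2' : x' < n) (h3' : 0 ≤ y') (h4' : y' < n) :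
    (grid n n).Adj (vtx n x y) (vtx n x' y') ↔
      ((x + 1 = x' ∨ x' + 1 = x) ∧ y = y') ∨ ((y + 1 = y' ∨ y' + 1 = y) ∧ x = x') := by
  unfold grid
  rw [SimpleGraph.boxProd_adj, SimpleGraph.pathGraph_adj, SimpleGraph.pathGraph_adj, Fin.ext_iff,
    Fin.ext_iff]
  have e1 := val_ofNat_toNat h1 h2
  have e2 := val_ofNat_toNat h3 h4
  have e1' := val_ofNat_toNat h1' h2'
  have e2' := val_ofNat_toNat h3' h4'
  simp only [vtx]
  omega

lemma neighborSet_grid_subset (x y : ℤ) (h1 : 0 ≤ x) (h2 : x < n) (h3 : 0 ≤ y) (h4 : y < n) :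
    (grid n n).neighborSet (vtx n x y) ⊆
      {vtx n (x + 1) y, vtx n (x - 1) y, vtx n x (y + 1), vtx n x (y - 1)} := by
  intro u hu
  rw [SimpleGraph.mem_neighborSet, ← vtx_val u] at hu
  have hu1 := u.1.2
  have hu2 := u.2.2
  rw [grid_adj_vtx h1 h2 h3 h4 (by omega) (by omega) (by omega) (by omega)] at hu
  rw [← vtx_val u]
  rcases hu with ⟨h | h, h'⟩ | ⟨h | h, h'⟩
  · left
    rw [h', h]
  · right; left
    rw [h', ← h, add_sub_cancel_right]
  · right; right; left
    rw [h', h]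
  · right; right; right
    rw [h', ← h, add_sub_cancel_right]
    rfl

lemma ncard_neighborSet_grid (u : Fin n × Fin n) : ((grid n n).neighborSet u).ncard ≤ 4 := by
  rw [← vtx_val u]
  refine (Set.ncard_le_ncard (neighborSet_grid_subset _ _ (by omega) (by omega) (by omega)
    (by omega))).trans ?_
  refine (Set.ncard_insert_le _ _).trans ?_
  refine (Nat.add_le_add_right (Set.ncard_insert_le _ _) 1).trans ?_
  refine (Nat.add_le_add_right (Nat.add_le_add_right (Set.ncard_insert_le _ _) 1) 1).trans ?_
  rw [Set.ncard_singleton]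

lemma neighborSet_grid (x y : ℤ) (h1 : 1 ≤ x) (h2 : x + 1 < n) (h3 : 1 ≤ y) (h4 : y + 1 < n) :
    (grid n n).neighborSet (vtx n x y) =
      {vtx n (x + 1) y, vtx n (x - 1) y, vtx n x (y + 1), vtx n x (y - 1)} := by
  refine Set.Subset.antisymm
    (neighborSet_grid_subset x y (by omega) (by omega) (by omega) (by omega)) ?_
  rintro u (rfl | rfl | rfl | rfl) <;>
    rw [SimpleGraph.mem_neighborSet, grid_adj_vtx (by omega) (by omega) (by omega) (by omega)
      (by omega) (by omega) (by omega) (by omega)] <;> omega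

/-- The charts of the grid, centred at `(p, q)` and with axes oriented by the signs `σ`, `τ`. -/
lemma isChart_grid {p q σ τ lo hi : ℤ} (hσ : σ = 1 ∨ σ = -1) (hτ : τ = 1 ∨ τ = -1)
    (h1 : 0 ≤ p + lo - 1) (h2 : 0 ≤ p - hi - 1) (h3 : p + hi + 1 < n) (h4 : p - lo + 1 < n)
    (h1' : 0 ≤ q + lo - 1) (h2' : 0 ≤ q - hi - 1) (h3' : q + hi + 1 < n) (h4' : q - lo + 1 < n) :
    IsChart (grid n n) (fun i j => vtx n (p + σ * i) (q + τ * j)) lo hi where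
  inj i j i' j' _ _ _ _ _ _ _ _ h := by
    rcases hσ with rfl | rfl <;> rcases hτ with rfl | rfl <;>
      rw [vtx_eq_iff (by omega) (by omega) (by omega) (by omega) (by omega) (by omega) (by omega)
        (by omega)] at h <;> omega
  nbrs i j _ _ _ _ := by
    have e1 : ∀ a k : ℤ, a + 1 * (k + 1) = a + 1 * k + 1 := fun a k => by ring
    have e2 : ∀ a k : ℤ, a + 1 * (k - 1) = a + 1 * k - 1 := fun a k => by ring
    have e3 : ∀ a k : ℤ, a + -1 * (k + 1) = a + -1 * k - 1 := fun a k => by ring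
    have e4 : ∀ a k : ℤ, a + -1 * (k - 1) = a + -1 * k + 1 := fun a k => by ring
    rcases hσ with rfl | rfl <;> rcases hτ with rfl | rfl <;>
      rw [neighborSet_grid _ _ (by omega) (by omega) (by omega) (by omega)] <;>
      simp only [e1, e2, e3, e4] <;> ext u <;>
      simp only [Set.mem_insert_iff, Set.mem_singleton_iff] <;> tauto

lemma connected_grid : (grid n n).Connected := by
  obtain ⟨m, rfl⟩ := Nat.exists_eq_succ_of_ne_zero (NeZero.ne n)
  exact (SimpleGraph.pathGraph_connected m).boxProd (SimpleGraph.pathGraph_connected m)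

lemma dist_vtx_fst_le (m : ℕ) {x y : ℤ} (h1 : 0 ≤ x) (h2 : x + m < n) (h3 : 0 ≤ y) (h4 : y < n) :
    (grid n n).dist (vtx n x y) (vtx n (x + m) y) ≤ m := by
  induction m with
  | zero => simp
  | succ m ih =>
    have hadj : (grid n n).Adj (vtx n (x + m) y) (vtx n (x + (m + 1 : ℕ)) y) := by
      rw [grid_adj_vtx (by omega) (by omega) (by omega) (by omega) (by omega) (by omega)
        (by omega) (by omega)]
      omega
    have h5 := (connected_grid (n := n)).dist_triangle (u := vtx n x y) (v := vtx n (x + m) y)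
      (w := vtx n (x + (m + 1 : ℕ)) y)
    rw [SimpleGraph.dist_eq_one_iff_adj.2 hadj] at h5
    have := ih (by omega)
    omega

lemma dist_vtx_snd_le (m : ℕ) {x y : ℤ} (h1 : 0 ≤ x) (h2 : x < n) (h3 : 0 ≤ y) (h4 : y + m < n) :
    (grid n n).dist (vtx n x y) (vtx n x (y + m)) ≤ m := by
  induction m with
  | zero => simp
  | succ m ih =>
    have hadj : (grid n n).Adj (vtx n x (y + m)) (vtx n x (y + (m + 1 : ℕ))) := by
      rw [grid_adj_vtx (by omega) (by omega) (by omega) (by omega) (by omega) (by omega)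
        (by omega) (by omega)]
      omega
    have h5 := (connected_grid (n := n)).dist_triangle (u := vtx n x y) (v := vtx n x (y + m))
      (w := vtx n x (y + (m + 1 : ℕ)))
    rw [SimpleGraph.dist_eq_one_iff_adj.2 hadj] at h5
    have := ih (by omega)
    omega

lemma dist_vtx_le {x y x' y' : ℤ} (h1 : 0 ≤ x) (h2 : x < n) (h3 : 0 ≤ y) (h4 : y < n)
    (h1' : 0 ≤ x') (h2' : x' < n) (h3' : 0 ≤ y') (h4' : y' < n) :
    (grid n n).dist (vtx n x y) (vtx n x' y') ≤ (x - x').natAbs + (y - y').natAbs := by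
  have e1 : (grid n n).dist (vtx n x y) (vtx n x' y) ≤ (x - x').natAbs := by
    rcases le_total x x' with h | h
    · have := dist_vtx_fst_le (n := n) (x' - x).natAbs (x := x) (y := y) h1 (by omega) h3 h4
      rw [show x + ((x' - x).natAbs : ℤ) = x' by omega] at this
      omega
    · have := dist_vtx_fst_le (n := n) (x - x').natAbs (x := x') (y := y) h1' (by omega) h3 h4
      rw [show x' + ((x - x').natAbs : ℤ) = x by omega, SimpleGraph.dist_comm] at this
      omega
  have e2 : (grid n n).dist (vtx n x' y) (vtx n x' y') ≤ (y - y').natAbs := by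
    rcases le_total y y' with h | h
    · have := dist_vtx_snd_le (n := n) (y' - y).natAbs (x := x') (y := y) h1' h2' h3 (by omega)
      rw [show y + ((y' - y).natAbs : ℤ) = y' by omega] at this
      omega
    · have := dist_vtx_snd_le (n := n) (y - y').natAbs (x := x') (y := y') h1' h2' h3' (by omega)
      rw [show y' + ((y - y').natAbs : ℤ) = y by omega, SimpleGraph.dist_comm] at this
      omega
  have := (connected_grid (n := n)).dist_triangle (u := vtx n x y) (v := vtx n x' y)
    (w := vtx n x' y')
  omega

end Grid

/-! ### Concatenated diagonal runs and a lattice of targets. -/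

section GridRun

variable {n : ℕ} [NeZero n] {d : ℕ} {γ : ℝ}

/-- The bound for the probability that a diagonal run of the grid fails. -/
def runBound (n : ℕ) (c : Correctors d γ) (M T₀ : ℕ) : ℝ :=
  (n * n : ℕ) * (1 / 10) ^ (4 * M + 6) +
    (2 * (d + 1 + c.bd) ^ 2 + 4 * c.bd ^ 2 * T₀) * 4 / M ^ 2

lemma fail_grid_diagonal_le (hd : 2 ≤ d) (c : Correctors d γ) (hγ : 0 ≤ γ) {M l : ℕ}
    (hM : 2 * (c.bd + d + 4) ≤ M) (hMl : M + 5 ≤ l) {T₀ : ℕ}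
    (hT1 : 2 * l + M + M / 2 + c.bd ≤ γ * T₀) (hT2 : γ * T₀ ≤ 2 * l + M + M / 2 + c.bd + 1)
    {p q σ τ : ℤ} (hσ : σ = 1 ∨ σ = -1) (hτ : τ = 1 ∨ τ = -1) (hp : l + M + 2 ≤ p)
    (hp' : p + l + M + 2 < n) (hq : l + M + 2 ≤ q) (hq' : q + l + M + 2 < n) :
    fail (grid n n) {vtx n p q} {vtx n (p + σ * l) (q + τ * l)} (20 * (4 * M + 6) + T₀) ≤
      runBound n c M T₀ := by
  have hφ := isChart_grid (n := n) (p := p) (q := q) (lo := -(2 * M + 6)) (hi := l + M + 1) hσ hτ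
    (by omega) (by omega) (by omega) (by omega) (by omega) (by omega) (by omega) (by omega)
  have := fail_diagonal_le hd c hγ ncard_neighborSet_grid connected_grid hM hφ ?_ hT1 hT2
  · simpa [runBound] using this
  · intro i j hi hj
    rw [abs_le] at hi hj
    have h : ∀ r k : ℤ, r = 1 ∨ r = -1 → -(2 * M + 3) ≤ k → k ≤ 2 * M + 3 →
        -(2 * M + 3) ≤ r * k ∧ r * k ≤ 2 * M + 3 := by
      rintro r k (rfl | rfl) h1 h2 <;> omega
    have h1 := h σ i hσ hi.1 hi.2
    have h2 := h τ j hτ hj.1 hj.2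
    simp only [mul_zero, add_zero]
    refine (dist_vtx_le (by omega) (by omega) (by omega) (by omega) (by omega) (by omega)
      (by omega) (by omega)).trans ?_
    omega

/-- Undoes the last of `N + 1` unit steps. At `a = 0` either sign works, parity forcing `1 ≤ N`. -/
lemma exists_sign_step {N : ℕ} {a : ℤ} (h1 : -(N + 1) ≤ a) (h2 : a ≤ N + 1)
    (h3 : (a + (N + 1)) % 2 = 0) :
    ∃ σ : ℤ, (σ = 1 ∨ σ = -1) ∧ -N ≤ a - σ ∧ a - σ ≤ N ∧ (a - σ + N) % 2 = 0 := by
  rcases le_or_gt 0 a with h | h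
  · exact ⟨1, Or.inl rfl, by omega, by omega, by omega⟩
  · exact ⟨-1, Or.inr rfl, by omega, by omega, by omega⟩

/-- Coordinates in `[-N, N]` with the parity of `N` are those reached by `N` diagonal steps. Each
run starts at coordinates of modulus at most `s - 1`, so `hm` leaves it room inside the grid. -/
lemma fail_grid_lattice_le (hd : 2 ≤ d) (c : Correctors d γ) (hγ : 0 ≤ γ) {M l m s : ℕ}
    (hM : 2 * (c.bd + d + 4) ≤ M) (hMl : M + 5 ≤ l) {T₀ : ℕ}
    (hT1 : 2 * l + M + M / 2 + c.bd ≤ γ * T₀) (hT2 : γ * T₀ ≤ 2 * l + M + M / 2 + c.bd + 1)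
    (hm : l * (s + 1) ≤ m) (hmn : 2 * m ≤ n) (N : ℕ) (hN : N ≤ s) (a b : ℤ)
    (ha : -N ≤ a) (ha' : a ≤ N) (ha2 : (a + N) % 2 = 0)
    (hb : -N ≤ b) (hb' : b ≤ N) (hb2 : (b + N) % 2 = 0) :
    fail (grid n n) {vtx n m m} {vtx n (m + a * l) (m + b * l)}
      (N * (20 * (4 * M + 6) + T₀)) ≤ N * runBound n c M T₀ := by
  induction N generalizing a b with
  | zero =>
    obtain rfl : a = 0 := by omega
    obtain rfl : b = 0 := by omega
    rw [fail_eq_zero (by simp)]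
    simp
  | succ N ih =>
    push_cast at ha ha' ha2 hb hb' hb2
    obtain ⟨σ, hσ, h1, h2, h3⟩ := exists_sign_step ha ha' ha2
    obtain ⟨τ, hτ, h4, h5, h6⟩ := exists_sign_step hb hb' hb2
    have hbound : ∀ e : ℤ, -N ≤ e → e ≤ N →
        l + M + 2 ≤ m + e * l ∧ m + e * l + l + M + 2 < n := by
      intro e he he'
      have hm' : ((l : ℤ) * (s + 1)) ≤ m := by exact_mod_cast hm
      have hl0 : (0 : ℤ) ≤ l := by omega
      have e1 : e * l ≤ (s - 1) * l := mul_le_mul_of_nonneg_right (by omega) hl0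
      have e2 : -(s - 1) * l ≤ e * l := mul_le_mul_of_nonneg_right (by omega) hl0
      have e3 : ((s : ℤ) - 1) * l = l * (s + 1) - 2 * l := by ring
      have e4 : -((s : ℤ) - 1) * l = 2 * l - l * (s + 1) := by ring
      rw [e3] at e1
      rw [e4] at e2
      constructor <;> omega
    have hA := hbound _ h1 h2
    have hB := hbound _ h4 h5
    have hstep := fail_grid_diagonal_le (n := n) hd c hγ hM hMl hT1 hT2 hσ hτ hA.1 hA.2 hB.1 hB.2
    have e1 : (m : ℤ) + (a - σ) * l + σ * l = m + a * l := by ring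
    have e2 : (m : ℤ) + (b - τ) * l + τ * l = m + b * l := by ring
    rw [e1, e2] at hstep
    have := fail_add (G := grid n n) {vtx n m m} {vtx n (m + (a - σ) * l) (m + (b - τ) * l)}
      {vtx n (m + a * l) (m + b * l)} (N * (20 * (4 * M + 6) + T₀)) (20 * (4 * M + 6) + T₀)
    rw [Nat.succ_mul]
    refine this.trans ?_
    push_cast
    linarith [ih (by omega) (a - σ) (b - τ) h1 h2 h3 h4 h5 h6]

/-- Every integer in the relevant range is close to a lattice point of the right parity. -/
lemma exists_lattice_near {l s : ℕ} (hl : 0 < l) {t : ℤ} (h1 : -((s + 1) * (l + 1)) ≤ t)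
    (h2 : t ≤ (s + 1) * (l + 1)) :
    ∃ i : Fin (s + 1), (t - (2 * (i : ℕ) - s) * l).natAbs ≤ 2 * l + s + 1 := by
  have e1 : ((s : ℤ) + 1) * (l + 1) = s * l + s + l + 1 := by ring
  rw [e1] at h1 h2
  rcases lt_or_ge t (-(s * l)) with h | h
  · refine ⟨0, ?_⟩
    have : t - (2 * (((0 : Fin (s + 1)) : ℕ) : ℤ) - s) * l = t + s * l := by
      rw [Fin.val_zero]
      push_cast
      ring
    rw [this]
    omega
  rcases lt_or_ge t (s * l) with h' | h'
  · have hq0 : 0 ≤ (t + s * l) / (2 * l) := Int.ediv_nonneg (by omega) (by omega)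
    have hqs : (t + s * l) / (2 * l) < s := by
      apply Int.ediv_lt_of_lt_mul (by omega)
      have : (s : ℤ) * (2 * l) = 2 * (s * l) := by ring
      omega
    refine ⟨⟨((t + s * l) / (2 * l)).toNat, by omega⟩, ?_⟩
    have h3 := Int.emod_add_mul_ediv (t + s * l) (2 * l)
    have h4 := Int.emod_nonneg (t + s * l) (show (2 * l : ℤ) ≠ 0 by omega)
    have h5 := Int.emod_lt_of_pos (t + s * l) (show (0 : ℤ) < 2 * l by omega)
    have h6 : t - (2 * (((t + s * l) / (2 * l)).toNat : ℤ) - s) * l = (t + s * l) % (2 * l) := by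
      rw [Int.toNat_of_nonneg hq0]
      linarith
    simp only
    rw [h6]
    omega
  · refine ⟨Fin.last s, ?_⟩
    have : t - (2 * ((Fin.last s : ℕ) : ℤ) - s) * l = t - s * l := by
      rw [Fin.val_last]
      ring
    rw [this]
    omega

/-- Union bound over `(s + 1) ^ 2` lattice points, then crude filling: each coordinate is within `2l
+ s + 1 ≤ 3l` of the lattice, hence distance `6l`. -/
lemma fail_grid_univ_le (hd : 2 ≤ d) (c : Correctors d γ) (hγ : 0 ≤ γ) {M l m s : ℕ}
    (hM : 2 * (c.bd + d + 4) ≤ M) (hMl : M + 5 ≤ l) (hsl : s + 1 ≤ l) {T₀ : ℕ}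
    (hT1 : 2 * l + M + M / 2 + c.bd ≤ γ * T₀) (hT2 : γ * T₀ ≤ 2 * l + M + M / 2 + c.bd + 1)
    (hm : l * (s + 1) ≤ m) (hmn : 2 * m ≤ n) (hnm : n ≤ 2 * m + 1)
    (hml : m ≤ (s + 1) * (l + 1)) :
    fail (grid n n) {vtx n m m} Set.univ (s * (20 * (4 * M + 6) + T₀) + 20 * (6 * l)) ≤
      (s + 1) ^ 2 * (s * runBound n c M T₀) + (n * n : ℕ) * (1 / 10) ^ (6 * l) := by
  have hm0 : 1 ≤ m := by nlinarith
  set pt : Fin (s + 1) × Fin (s + 1) → Fin n × Fin n := fun e =>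
    vtx n (m + (2 * (e.1 : ℕ) - s) * l) (m + (2 * (e.2 : ℕ) - s) * l) with hpt
  set S : Set (Fin n × Fin n) := ⋃ e ∈ (Finset.univ : Finset (Fin (s + 1) × Fin (s + 1))), {pt e}
  have h1 : fail (grid n n) {vtx n m m} S (s * (20 * (4 * M + 6) + T₀)) ≤
      (s + 1) ^ 2 * (s * runBound n c M T₀) := by
    refine (fail_biUnion_le _ _ _ _).trans ?_
    refine (Finset.sum_le_sum fun e _ => fail_grid_lattice_le hd c hγ hM hMl hT1 hT2 hm hmn s le_rfl
      (2 * (e.1 : ℕ) - s) (2 * (e.2 : ℕ) - s) (by omega) (by omega) (by omega) (by omega) (by omega)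
      (by omega)).trans (le_of_eq ?_)
    rw [Finset.sum_const, Finset.card_univ, Fintype.card_prod, Fintype.card_fin, nsmul_eq_mul]
    push_cast
    ring
  have h2 : fail (grid n n) S Set.univ (20 * (6 * l)) ≤ (n * n : ℕ) * (1 / 10) ^ (6 * l) := by
    have := fail_le_of_dist (G := grid n n) (Z := S) (B := Set.univ) (D := 6 * l)
      ncard_neighborSet_grid connected_grid ?_
    · simpa using this
    intro w _
    have hw1 := w.1.2
    have hw2 := w.2.2
    have hml' : (m : ℤ) ≤ (s + 1) * (l + 1) := by exact_mod_cast hml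
    have hm' : ((l : ℤ) * (s + 1)) ≤ m := by exact_mod_cast hm
    obtain ⟨i, hi⟩ := exists_lattice_near (l := l) (s := s) (t := (w.1 : ℕ) - m) (by omega)
      (by omega) (by omega)
    obtain ⟨j, hj⟩ := exists_lattice_near (l := l) (s := s) (t := (w.2 : ℕ) - m) (by omega)
      (by omega) (by omega)
    have hin : ∀ i : Fin (s + 1), 0 ≤ m + (2 * ((i : ℕ) : ℤ) - s) * l ∧
        m + (2 * ((i : ℕ) : ℤ) - s) * l < n := by
      intro i
      have hi2 := i.is_le
      have hl0 : (0 : ℤ) ≤ l := by omega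
      have e1 : (2 * ((i : ℕ) : ℤ) - s) * l ≤ s * l := mul_le_mul_of_nonneg_right (by omega) hl0
      have e2 : -s * l ≤ (2 * ((i : ℕ) : ℤ) - s) * l := mul_le_mul_of_nonneg_right (by omega) hl0
      have e3 : (l : ℤ) * (s + 1) = s * l + l := by ring
      have e4 : -(s : ℤ) * l = -(s * l) := by ring
      rw [e4] at e2
      rw [e3] at hm'
      constructor <;> omega
    refine ⟨pt (i, j), by simp [S], ?_⟩
    have hi' := hin i
    have hj' := hin j
    conv_lhs => rw [← vtx_val w]
    refine (dist_vtx_le hi'.1 hi'.2 hj'.1 hj'.2 (by omega) (by omega) (by omega) (by omega)).trans ?_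
    omega
  exact (fail_add _ S _ _ _).trans (add_le_add h1 h2)

end GridRun

/-! ### Choice of scales and the limit. -/

section Asymptotics

variable {d : ℕ} {γ : ℝ}

lemma cube_le_ten_pow (M : ℕ) : ((M : ℝ) + 1) ^ 3 ≤ 10 ^ M := by
  induction M with
  | zero => norm_num
  | succ M ih =>
    rw [pow_succ 10]
    push_cast
    have : (0 : ℝ) ≤ M := Nat.cast_nonneg M
    nlinarith [pow_nonneg this 2, pow_nonneg this 3]

lemma one_div_ten_pow_le {M k : ℕ} (h : M ≤ k) : ((1 : ℝ) / 10) ^ k ≤ 1 / (M + 1) ^ 3 := by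
  calc ((1 : ℝ) / 10) ^ k ≤ (1 / 10) ^ M := pow_le_pow_of_le_one (by norm_num) (by norm_num) h
    _ = 1 / 10 ^ M := by rw [one_div_pow]
    _ ≤ _ := one_div_le_one_div_of_le (by positivity) (cube_le_ten_pow M)

/-- The constant in the bound for the probability of failure, for a lattice of mesh `n / (2 s + 2)`. -/
def failConst (c : Correctors d γ) (s : ℕ) : ℝ :=
  (s + 1) ^ 2 * (s * ((2 * (s + 1) ^ 2) ^ 2 +
    16 * (2 * (d + 1 + c.bd) ^ 2 + 4 * c.bd ^ 2 * ((2 * (s + 1) + 4) / γ)))) +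
    (2 * (s + 1) ^ 2) ^ 2

lemma mul_one_div_ten_pow_le {n M k : ℕ} {A : ℝ} (hn : n ≤ A * (M + 1)) (hk : M ≤ k) :
    ((n * n : ℕ) : ℝ) * (1 / 10) ^ k ≤ A ^ 2 / (M + 1) := by
  have hn0 : (0 : ℝ) ≤ n := Nat.cast_nonneg n
  have hA := hn0.trans hn
  push_cast
  calc (n : ℝ) * n * (1 / 10) ^ k ≤ (A * (M + 1)) * (A * (M + 1)) * (1 / (M + 1) ^ 3) :=
        mul_le_mul (mul_le_mul hn hn hn0 hA) (one_div_ten_pow_le hk) (by positivity)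
          (mul_nonneg hA hA)
    _ = A ^ 2 / (M + 1) := by field_simp

lemma runBound_le {n : ℕ} (c : Correctors d γ) {M T₀ : ℕ} {A τ : ℝ} (hM : 1 ≤ M)
    (hn : n ≤ A * (M + 1)) (hτ : 0 ≤ τ) (hT : T₀ ≤ τ * (M + 1)) :
    runBound n c M T₀ ≤ (A ^ 2 + 16 * (2 * (d + 1 + c.bd) ^ 2 + 4 * c.bd ^ 2 * τ)) / (M + 1) := by
  have hM' : (1 : ℝ) ≤ M := by exact_mod_cast hM
  unfold runBound
  rw [add_div]
  refine add_le_add (mul_one_div_ten_pow_le hn (by omega)) ?_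
  set E : ℝ := 2 * (d + 1 + c.bd) ^ 2 + 4 * c.bd ^ 2 * τ with hE
  have hE0 : 0 ≤ E := by positivity
  have e1 : 2 * (d + 1 + c.bd) ^ 2 + 4 * c.bd ^ 2 * T₀ ≤ E * (M + 1) := by
    have e2 : 4 * c.bd ^ 2 * T₀ ≤ 4 * c.bd ^ 2 * (τ * (M + 1)) :=
      mul_le_mul_of_nonneg_left hT (by positivity)
    have e3 : 2 * (d + 1 + c.bd) ^ 2 * 1 ≤ 2 * (d + 1 + c.bd) ^ 2 * ((M : ℝ) + 1) :=
      mul_le_mul_of_nonneg_left (by linarith) (by positivity)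
    rw [hE, add_mul]
    linarith
  calc _ ≤ E * (M + 1) * 4 / M ^ 2 := by gcongr
    _ ≤ 16 * E / (M + 1) := by
        rw [div_le_div_iff₀ (by positivity) (by positivity)]
        have : ((M : ℝ) + 1) * (M + 1) ≤ 4 * M ^ 2 := by nlinarith
        nlinarith [mul_le_mul_of_nonneg_left this hE0]

/-- For fixed `s`, the quantities `n`, `l` and `T₀` are all `O(M)`, so every contribution is `O(1 /
M)`. -/
lemma total_fail_le {n : ℕ} (c : Correctors d γ) (hγ : 0 < γ) {s l M T₀ : ℕ} (hM1 : 1 ≤ M)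
    (hM : 2 * (c.bd + d + 4) ≤ M) (hMl : M ≤ l) (hlM : l ≤ (s + 1) * (M + 1))
    (hn : n ≤ 2 * (s + 1) ^ 2 * (M + 1))
    (hT : γ * T₀ ≤ 2 * l + M + M / 2 + c.bd + 1) :
    (s + 1) ^ 2 * (s * runBound n c M T₀) + (n * n : ℕ) * (1 / 10) ^ (6 * l) ≤
      failConst c s / (M + 1) := by
  have hnA : (n : ℝ) ≤ 2 * (s + 1) ^ 2 * (M + 1) := by exact_mod_cast hn
  have hl2 : (l : ℝ) ≤ (s + 1) * (M + 1) := by exact_mod_cast hlM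
  have hd0 : (0 : ℝ) ≤ d := Nat.cast_nonneg d
  have hTE : (T₀ : ℝ) ≤ ((2 * (s + 1) + 4) / γ) * (M + 1) := by
    rw [div_mul_eq_mul_div, le_div_iff₀ hγ]
    linarith
  have hrun := runBound_le c hM1 hnA (by positivity) hTE
  have hlast := mul_one_div_ten_pow_le (k := 6 * l) hnA (by omega)
  have h1 : ((s : ℝ) + 1) ^ 2 * (s * runBound n c M T₀) ≤ (s + 1) ^ 2 * (s * _) :=
    mul_le_mul_of_nonneg_left (mul_le_mul_of_nonneg_left hrun (Nat.cast_nonneg s)) (by positivity)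
  refine (add_le_add h1 hlast).trans (le_of_eq ?_)
  unfold failConst
  ring

/-- The main term is `s K / γ ≤ n / γ`. Start-ups (`80 M s ≤ 80 l`) and filling (`120 l`) cost `200
l ≤ η n / 2`; the additive `120 s`, with `s` from rounding, costs `121 s ≤ η n / 2`. -/
lemma total_time_le (hγ : 0 < γ) (hγ1 : γ ≤ 1) {η K : ℝ} (hη : 0 < η) {n s l M T₀ : ℕ}
    (hs : 200 ≤ s * η) (hn : 242 * s ≤ n * η) (hMl : M * (s + 1) ≤ l)
    (hln : l * (2 * (s + 1)) ≤ n) (hK : K ≤ 2 * l + 2 * M) (hT : T₀ ≤ K / γ + 1) :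
    (s * (20 * (4 * M + 6) + T₀) + 20 * (6 * l) : ℝ) ≤ (1 + η) * γ⁻¹ * n := by
  have hγi : 1 ≤ γ⁻¹ := (one_le_inv₀ hγ).2 hγ1
  have hMlr : (M : ℝ) * (s + 1) ≤ l := by exact_mod_cast hMl
  have hlnr : (l : ℝ) * (2 * (s + 1)) ≤ n := by exact_mod_cast hln
  have hM0 : (0 : ℝ) ≤ M := Nat.cast_nonneg M
  have hl0 : (0 : ℝ) ≤ l := Nat.cast_nonneg l
  have hsT : (s : ℝ) * T₀ ≤ n * γ⁻¹ + s := by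
    have e1 : (s : ℝ) * K ≤ n := by
      calc (s : ℝ) * K ≤ s * (2 * l + 2 * M) := by gcongr
        _ ≤ n := by linarith
    calc (s : ℝ) * T₀ ≤ s * (K / γ + 1) := by gcongr
      _ = s * K * γ⁻¹ + s := by ring
      _ ≤ _ := by gcongr
  have hη1 : 200 * (l : ℝ) ≤ η / 2 * n := by
    have e1 := mul_le_mul_of_nonneg_right hs hl0
    have e2 := mul_le_mul_of_nonneg_left hlnr hη.le
    have e3 := mul_nonneg hη.le hl0
    linarith
  have hηγ : η * 1 * n ≤ η * γ⁻¹ * n := by gcongr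
  linarith

/-- The grid is blue in time `(1 + η) n / γ`, with high probability. -/
lemma eventually_fail_grid_le (hd : 2 ≤ d) (c : Correctors d γ) (hγ : 0 < γ) (hγ1 : γ ≤ 1) {η δ : ℝ}
    (hη : 0 < η) (hδ : 0 < δ) :
    ∀ᶠ n : ℕ in atTop, ∃ (v : Fin n × Fin n) (T : ℕ),
      fail (grid n n) {v} Set.univ T ≤ δ ∧ (T : ℝ) ≤ (1 + η) * γ⁻¹ * n := by
  obtain ⟨s, hs⟩ := exists_nat_ge (200 / η)
  rw [div_le_iff₀ hη] at hs
  have hs0 : s ≠ 0 := by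
    rintro rfl
    norm_num at hs
  have hbd : 0 ≤ c.bd := (abs_nonneg _).trans (c.abs_lev (allBlue d))
  -- Two scales: `l ≈ n / (2(s + 1))` is the length of a run, and `M ≈ l / (s + 1)` makes the bands
  -- narrow enough for `s` start-ups to be cheap.
  have hM : Tendsto (fun n : ℕ => n / (2 * (s + 1)) / (s + 1)) atTop atTop :=
    (Nat.tendsto_div_const_atTop (by omega)).comp (Nat.tendsto_div_const_atTop (by omega))
  have hMr : Tendsto (fun n : ℕ => ((n / (2 * (s + 1)) / (s + 1) : ℕ) : ℝ)) atTop atTop :=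
    tendsto_natCast_atTop_atTop.comp hM
  filter_upwards [hM.eventually_ge_atTop (s + 10), hMr.eventually_ge_atTop (2 * (c.bd + d + 4)),
    hMr.eventually_ge_atTop (failConst c s / δ), eventually_gt_atTop 0,
    tendsto_natCast_atTop_atTop.eventually_ge_atTop (242 * s / η : ℝ)] with n h1 h2 h3 h4 h5
  have : NeZero n := ⟨h4.ne'⟩
  rw [div_le_iff₀ hη] at h5
  rw [div_le_iff₀ hδ] at h3
  set l := n / (2 * (s + 1)) with hl
  set M := l / (s + 1) with hMdef
  have hMl : M * (s + 1) ≤ l := Nat.div_mul_le_self _ _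
  have hlM : l < (s + 1) * (M + 1) := Nat.lt_mul_div_succ l (by omega)
  have hln : l * (2 * (s + 1)) ≤ n := Nat.div_mul_le_self _ _
  have hnl : n < 2 * (s + 1) * (l + 1) := Nat.lt_mul_div_succ n (by omega)
  clear_value l M
  set K : ℝ := 2 * l + M + M / 2 + c.bd with hK
  have hK0 : 0 ≤ K := by positivity
  set T₀ := ⌈K / γ⌉₊ with hT₀
  have hT1 : K ≤ γ * T₀ := by
    have := Nat.le_ceil (K / γ)
    rwa [div_le_iff₀ hγ, mul_comm] at this
  have hT3 : (T₀ : ℝ) ≤ K / γ + 1 := (Nat.ceil_lt_add_one (by positivity)).le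
  have hT2 : γ * T₀ ≤ K + 1 := by
    calc γ * T₀ ≤ γ * (K / γ + 1) := mul_le_mul_of_nonneg_left hT3 hγ.le
      _ = K + γ := by field_simp
      _ ≤ K + 1 := by linarith
  clear_value T₀
  have hM2 : M * 2 ≤ M * (s + 1) := Nat.mul_le_mul_left _ (by omega)
  have hfail := fail_grid_univ_le (n := n) (m := n / 2) (s := s) hd c hγ.le h2 (by omega)
    (by omega) hT1 hT2 (by rw [Nat.le_div_iff_mul_le (by norm_num)]; linarith) (by omega)
    (by omega)
    (by
      have : n / 2 < (s + 1) * (l + 1) := by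
        rw [Nat.div_lt_iff_lt_mul (by norm_num)]
        linarith
      exact this.le)
  refine ⟨_, _, hfail.trans ((total_fail_le c hγ (by omega) h2 (by omega) hlM.le ?_ hT2).trans ?_),
    ?_⟩
  · calc n ≤ 2 * (s + 1) * (l + 1) := hnl.le
      _ ≤ 2 * (s + 1) * ((s + 1) * (M + 1)) := Nat.mul_le_mul_left _ hlM
      _ = _ := by ring
  · rw [div_le_iff₀ (by positivity)]
    linarith
  · have hd0 : (0 : ℝ) ≤ d := Nat.cast_nonneg d
    push_cast
    exact total_time_le hγ hγ1 hη hs h5 hMl hln (by linarith) hT3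

/-- Diagonal argument: `f n` is the largest `k ≤ n` whose threshold `n` has passed. -/
lemma exists_tendsto_atTop_of_eventually {Q : ℕ → ℕ → Prop} (h : ∀ k, ∀ᶠ n in atTop, Q k n) :
    ∃ f : ℕ → ℕ, Tendsto f atTop atTop ∧ ∀ᶠ n in atTop, Q (f n) n := by
  choose N hN using fun k => eventually_atTop.1 (h k)
  refine ⟨fun n => Nat.findGreatest (fun k => N k ≤ n) n, tendsto_atTop.2 fun k => ?_, ?_⟩
  · filter_upwards [eventually_ge_atTop k, eventually_ge_atTop (N k)] with n h1 h2
    exact Nat.le_findGreatest h1 h2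
  · filter_upwards [eventually_ge_atTop (N 0)] with n hn
    exact hN _ n (Nat.findGreatest_spec (P := fun k => N k ≤ n) (Nat.zero_le n) hn)

/-- A single good run suffices, since the minimum over starting vertices can only be smaller. -/
lemma le_expMeasure_propTime {V : Type*} [Fintype V] {G : SimpleGraph V} {v : V} {T : ℕ} {X : ℝ}
    (hT : (T : ℝ) ≤ X) :
    ENNReal.ofReal (1 - fail G {v} Set.univ T) ≤
      expMeasure V {ω | ∃ t : ℕ, propTime G ω = (t : ℕ∞) ∧ (t : ℝ) ≤ X} := by
  have hm := measurableSet_fail (G := G) {v} Set.univ T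
  have h1 : ENNReal.ofReal (1 - fail G {v} Set.univ T) =
      runMeasure V {ω | ¬ Set.univ ⊆ blueSet G {v} ω T}ᶜ := by
    rw [fail, ← probReal_compl_eq_one_sub hm, measureReal_def, ENNReal.ofReal_toReal
      (measure_ne_top _ _)]
  have h2 : expMeasure V ((fun ω : ExpSpace V => ω v) ⁻¹'
      {ω | ¬ Set.univ ⊆ blueSet G {v} ω T}ᶜ) =
      runMeasure V {ω | ¬ Set.univ ⊆ blueSet G {v} ω T}ᶜ :=
    (measurePreserving_eval (fun _ : V => runMeasure V) v).measure_preimage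
      hm.compl.nullMeasurableSet
  rw [h1, ← h2]
  refine measure_mono fun ω hω => ?_
  have hblue : blueSet G {v} (ω v) T = Set.univ := by
    have : Set.univ ⊆ blueSet G {v} (ω v) T := by
      by_contra hc
      exact hω hc
    exact Set.univ_subset_iff.1 this
  have hle : propTime G ω ≤ (T : ℕ∞) :=
    (iInf_le _ v).trans (iInf₂_le (f := fun (t : ℕ) (_ : blueSet G {v} (ω v) t = Set.univ) =>
      (t : ℕ∞)) T hblue)
  obtain ⟨t, ht⟩ := ENat.ne_top_iff_exists.1 (ne_top_of_le_ne_top (ENat.natCast_ne_top T) hle)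
  rw [← ht] at hle
  have htT : t ≤ T := by exact_mod_cast hle
  exact ⟨t, ht.symm, le_trans (by exact_mod_cast htT) hT⟩

end Asymptotics

end PZF

end

theorem corollary4p4 (d : ℕ) (hd : 2 ≤ d) :
    ∃ π : PZF.Config d → ℝ,
      PZF.IsStationary (PZF.windowChain d) π ∧
      PZF.IsLimiting (PZF.windowChain d) π ∧
      π (PZF.allWhite d) < 1 / 2 ∧
      ∃ ε : ℕ → ℝ, Tendsto ε atTop (𝓝 0) ∧
        Tendsto
          (fun n : ℕ => PZF.expMeasure (Fin n × Fin n)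
            {ω | ∃ t : ℕ, PZF.propTime (PZF.grid n n) ω = (t : ℕ∞) ∧
              (t : ℝ) ≤ (1 + ε n) *
                ((1 - π (PZF.allWhite d)) / (1 - 2 * π (PZF.allWhite d))) * (n : ℝ)})
          atTop (𝓝 1) := by
  obtain ⟨π, hs, hl⟩ := PZF.exists_isStationary_windowChain hd
  have hμ := PZF.stationary_allWhite_lt hd hs
  have hμ0 := hs.1 (PZF.allWhite d)
  obtain ⟨c⟩ := PZF.exists_correctors hd hs hl
  have hγ : 0 < (1 - 2 * π (PZF.allWhite d)) / (1 - π (PZF.allWhite d)) :=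
    div_pos (by linarith) (by linarith)
  have hγ1 : (1 - 2 * π (PZF.allWhite d)) / (1 - π (PZF.allWhite d)) ≤ 1 := by
    rw [div_le_one (by linarith)]
    linarith
  -- The same sequence `1 / (f n + 1)` serves as `ε n` and as the bound on the failure probability.
  obtain ⟨f, hf, hfn⟩ := PZF.exists_tendsto_atTop_of_eventually fun k : ℕ =>
    PZF.eventually_fail_grid_le hd c hγ hγ1 (η := 1 / ((k : ℝ) + 1)) (δ := 1 / ((k : ℝ) + 1))
      (by positivity) (by positivity)
  have hε : Tendsto (fun n => 1 / ((f n : ℝ) + 1)) atTop (𝓝 0) :=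
    tendsto_one_div_add_atTop_nhds_zero_nat.comp hf
  refine ⟨π, hs, hl, hμ, fun n => 1 / ((f n : ℝ) + 1), hε, ?_⟩
  have hlow : Tendsto (fun n => ENNReal.ofReal (1 - 1 / ((f n : ℝ) + 1))) atTop (𝓝 1) := by
    have := ENNReal.tendsto_ofReal (hε.const_sub 1)
    simpa using this
  refine tendsto_of_tendsto_of_tendsto_of_le_of_le' hlow tendsto_const_nhds ?_ ?_
  · filter_upwards [hfn] with n hn
    obtain ⟨v, T, hfail, hT⟩ := hn
    rw [inv_div] at hT
    exact (ENNReal.ofReal_le_ofReal (sub_le_sub_left hfail 1)).trans (PZF.le_expMeasure_propTime hT)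
  · refine Eventually.of_forall fun n => ?_
    have : IsProbabilityMeasure (PZF.expMeasure (Fin n × Fin n)) := by
      unfold PZF.expMeasure
      infer_instance
    exact prob_le_one
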